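/- A deterministic two-party protocol $\pi$ with input sets $\mathcal X,\mathcal Y$ specifies, for every history (the string of bits received so far), whether the communication is over and, if not, which party sends the next bit, together with the bit that is sent, as a function of the sender's own input and the history. Over $\mathrm{BSC}_p$ with feedback ($0\le p\le \tfrac12$) every sent bit is independently flipped with probability $p$, and both parties see the received bit; the transcript is the string of all received bits. $CC(\pi)$ denotes the maximum number of bits exchanged, over all inputs and all channel outcomes of positive probability, and is assumed finite. A public-coin protocol $\phi$ over the noiseless channel is a deterministic protocol whose rules (when to stop, who speaks, and which bit is sent) may in addition depend on shared randomness $R$ that is independent of the inputs; $\overline{CC}(\phi)$ denotes the maximum over inputs $(x,y)$ of the expected number of bits exchanged over the choice of $R$. We say that $\phi$ simulates $\pi$ if there is a deterministic function $g$ of the shared randomness and the transcript of $\phi$ (not depending on the inputs) such that for every input $(x,y)$ the random variable $g(R,\Phi(x,y,R))$ has exactly the same distribution as the transcript $\Pi(x,y)$ of $\pi$, where $\Phi(x,y,R)$ is the transcript of $\phi$. **Theorem 3.1.** There is an absolute constant $\alpha>0$ such that for all sets $\mathcal X,\mathcal Y$, every $0\le\epsilon\le\tfrac12$ and every deterministic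 protocol $\pi$ over $\mathrm{BSC}_{1/2-\epsilon}$ with feedback, there is a public-coin protocol $\phi$ over the noiseless channel such that $\phi$ simulates $\pi$ and $$\overline{CC}(\phi)\;\le\;\alpha\cdot\lceil 2\epsilon^2\cdot CC(\pi)\rceil .$$ -/

import Mathlib

open scoped ENNReal

/-- The two parties of a communication protocol. -/
inductive Party where
  | alice
  | bob

/-- A deterministic two-party protocol with inputs `x : X` (Alice) and `y : Y` (Bob).
The history is the list of all bits *received* so far, oldest first; over a channel with
feedback, as over a noiseless channel, both parties know it. The history alone determines
whether the communication is over and, if not, who speaks next; the bit handed to the channel is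
a function of the speaker's own input and the history. -/
structure Protocol (X : Type*) (Y : Type*) where
  /-- `none`: the communication is over; `some q`: party `q` sends the next bit. -/
  next : List Bool → Option Party
  /-- The bit that Alice sends when it is her turn. -/
  aliceBit : X → List Bool → Bool
  /-- The bit that Bob sends when it is his turn. -/
  bobBit : Y → List Bool → Bool

namespace Protocol

variable {X : Type*} {Y : Type*}

/-- The bit that is sent after history `h` on inputs `x, y`; `none` if the communication is over. -/
def sentBit (π : Protocol X Y) (x : X) (y : Y) (h : List Bool) : Option Bool :=
  match π.next h with
  | none => none
  | some .alice => some (π.aliceBit x h)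
  | some .bob => some (π.bobBit y h)

/-- The history after (at most) `n` rounds over the noiseless channel. -/
def run (π : Protocol X Y) (x : X) (y : Y) : ℕ → List Bool
  | 0 => []
  | n + 1 =>
    match π.sentBit x y (π.run x y n) with
    | none => π.run x y n
    | some b => π.run x y n ++ [b]

/-- Over the noiseless channel, on inputs `x, y`, the protocol halts with complete transcript `s`. -/
def HaltsWith (π : Protocol X Y) (x : X) (y : Y) (s : List Bool) : Prop :=
  π.next s = none ∧ ∃ n, π.run x y n = s

/-- Number of bits exchanged over the noiseless channel (`∞` if the protocol never halts). -/
noncomputable def numBits (π : Protocol X Y) (x : X) (y : Y) : ℝ≥0∞ :=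
  ⨆ n, ((π.run x y n).length : ℝ≥0∞)

end Protocol

/-- The binary symmetric channel with crossover probability `p`: given the sent bit `b`, the law of
the received bit, which is the flip of `b` with probability `p`. -/
noncomputable def bsc (p : ℝ) (hp : p ∈ Set.Icc (0 : ℝ) (1 / 2)) (b : Bool) : PMF Bool :=
  PMF.ofFintype (fun r => ENNReal.ofReal (if r = b then 1 - p else p)) (by
    have h0 : 0 ≤ p := hp.1
    have h1 : 0 ≤ 1 - p := by linarith [hp.2]
    cases b <;> simp [← ENNReal.ofReal_add h0 h1, ← ENNReal.ofReal_add h1 h0])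

namespace Protocol

variable {X : Type*} {Y : Type*}

/-- The law of the history after (at most) `n` rounds when every sent bit goes independently through
the memoryless channel `C` with feedback (the history consists of the received bits). -/
noncomputable def historyLaw (C : Bool → PMF Bool) (π : Protocol X Y) (x : X) (y : Y) :
    ℕ → PMF (List Bool)
  | 0 => PMF.pure []
  | n + 1 => (π.historyLaw C x y n).bind fun h =>
    match π.sentBit x y h with
    | none => PMF.pure h
    | some b => (C b).map fun r => h ++ [r]

open Classical in
/-- The probability that the protocol, run over the channel `C` with feedback on inputs `x, y`, halts
with complete transcript `t`. (For a `t` at which the communication is over, the events "the history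
after `n` rounds is `t`" increase with `n`.) -/
noncomputable def transcriptProb (C : Bool → PMF Bool) (π : Protocol X Y) (x : X) (y : Y)
    (t : List Bool) : ℝ≥0∞ :=
  if π.next t = none then ⨆ n, π.historyLaw C x y n t else 0

/-- Communication complexity over the channel `C` with feedback: the maximum number of bits exchanged,
over all inputs and all histories that occur with positive probability. -/
noncomputable def channelCC (C : Bool → PMF Bool) (π : Protocol X Y) : ℕ∞ :=
  ⨆ (x : X) (y : Y) (n : ℕ) (h : List Bool) (_ : h ∈ (π.historyLaw C x y n).support),
    (h.length : ℕ∞)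

end Protocol

/-- A public-coin protocol over the noiseless channel: a random deterministic protocol, drawn with
the shared randomness `ω : Ω`, which both parties see. -/
structure PublicCoinProtocol (X : Type*) (Y : Type*) where
  /-- The space of the shared randomness. -/
  Ω : Type
  [mΩ : MeasurableSpace Ω]
  [borel : StandardBorelSpace Ω]
  /-- The law of the shared randomness. -/
  μ : MeasureTheory.Measure Ω
  [prob : MeasureTheory.IsProbabilityMeasure μ]
  /-- The deterministic protocol that is followed once the shared randomness is fixed. -/
  prot : Ω → Protocol X Y
  measurableSet_next : ∀ h q, MeasurableSet {ω | (prot ω).next h = q}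
  measurableSet_aliceBit : ∀ x h b, MeasurableSet {ω | (prot ω).aliceBit x h = b}
  measurableSet_bobBit : ∀ y h b, MeasurableSet {ω | (prot ω).bobBit y h = b}

namespace PublicCoinProtocol

variable {X : Type*} {Y : Type*}

attribute [instance] PublicCoinProtocol.mΩ PublicCoinProtocol.borel PublicCoinProtocol.prob

/-- Average communication complexity: the expected number of bits exchanged, over the shared
randomness, on the worst input. -/
noncomputable def avgCC (φ : PublicCoinProtocol X Y) : ℝ≥0∞ :=
  ⨆ (x : X) (y : Y), ∫⁻ ω, (φ.prot ω).numBits x y ∂φ.μ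

/-- `φ` (over the noiseless channel) simulates `π` (over the channel `C` with feedback): there is a
deterministic function `g` of the shared randomness and the transcript of `φ`, not depending on the
inputs, such that on every input the value of `g` has exactly the law of the transcript of `π`. -/
def Simulates (φ : PublicCoinProtocol X Y) (C : Bool → PMF Bool) (π : Protocol X Y) : Prop :=
  ∃ g : φ.Ω → List Bool → List Bool,
    (∀ s t, MeasurableSet {ω | g ω s = t}) ∧
    ∀ (x : X) (y : Y) (t : List Bool),
      φ.μ {ω | ∃ s, (φ.prot ω).HaltsWith x y s ∧ g ω s = t} = π.transcriptProb C x y t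

end PublicCoinProtocol

-- The density of the received bits with respect to uniform bits is a product of factors `1 ± 2ε`.
-- It splits as a likelihood ratio known to Alice times one known to Bob. Over about `1 / ε ^ 2`
-- bits neither ratio moves by more than a constant factor, except with small probability. A whole
-- block of that length can therefore be sampled at once by rejection, for O(1) expected bits.
--
-- In one trial, public coins propose `16 ^ m` uniform bits, where `8192 ε ^ 2 16 ^ m ≤ 1` unless `m
-- = 0`. The proposal is cut at the first time some party's ratio reaches a barrier, so both ratios
-- are at most 16. Each party then accepts with probability its ratio over 16. Along uniform bits,
-- the product of the ratios times any function harmonic for the protocol is a martingale. By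
-- optional stopping, the acceptance probability is exactly `1 / 256`, and a trial, whether it
-- succeeds or fails, leaves the law of the final transcript unchanged (`trialLaw_bind_completion`).
--
-- Announcing an arbitrary stopping time would cost about `log (1 / ε)` bits. To avoid this, the
-- barrier is `exp (2 - 2⁻ʲ)` at times of grid level `j`, with mesh `16 ^ (m - j)`. Stopping at
-- level `j + 1` forces a gain of `exp (2 ^ (-(j + 1)))` since the preceding coarser grid point, and
-- a moment bound makes this so rare that the mean level is at most `2⁻¹⁰` (`expect_gridLevel_le`).
-- A time of level `j` costs O(1 + j) bits, so a trial costs at most 11 bits, and an accepted full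
-- block has probability at least `1 / 512`. Hence O(1) bits are spent per block, and the number of
-- blocks is O(⌈2 ε ^ 2 T⌉).

universe u v w z

/-! ### Expectations under probability mass functions -/

namespace PMF

/-- The expectation of a nonnegative function under a probability mass function. -/
noncomputable def expect {α : Type u} (p : PMF α) (φ : α → ℝ≥0∞) : ℝ≥0∞ := ∑' a, p a * φ a

variable {α : Type u} {β : Type v} {γ : Type w}

theorem bind_apply_eq_expect (p : PMF α) (f : α → PMF β) (b : β) :
    p.bind f b = p.expect fun a => f a b := rfl

@[simp] theorem expect_pure (a : α) (φ : α → ℝ≥0∞) : (PMF.pure a).expect φ = φ a := by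
  classical
  unfold expect
  rw [tsum_eq_single a]
  · simp
  · intro b hb
    simp [hb]

theorem expect_bind (p : PMF α) (f : α → PMF β) (φ : β → ℝ≥0∞) :
    (p.bind f).expect φ = p.expect fun a => (f a).expect φ := by
  simp only [expect, bind_apply, ← ENNReal.tsum_mul_right, ← ENNReal.tsum_mul_left]
  rw [ENNReal.tsum_comm]
  simp only [mul_assoc]

theorem expect_map (p : PMF α) (f : α → β) (φ : β → ℝ≥0∞) :
    (p.map f).expect φ = p.expect fun a => φ (f a) := by
  rw [← bind_pure_comp, expect_bind]
  simp

theorem expect_mono (p : PMF α) {φ ψ : α → ℝ≥0∞} (h : ∀ a, φ a ≤ ψ a) :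
    p.expect φ ≤ p.expect ψ :=
  ENNReal.tsum_le_tsum fun a => by gcongr; exact h a

theorem expect_add (p : PMF α) (φ ψ : α → ℝ≥0∞) :
    (p.expect fun a => φ a + ψ a) = p.expect φ + p.expect ψ := by
  simp only [expect, mul_add, ENNReal.tsum_add]

@[simp] theorem expect_const (p : PMF α) (c : ℝ≥0∞) : (p.expect fun _ => c) = c := by
  simp only [expect, ENNReal.tsum_mul_right, p.tsum_coe, one_mul]

theorem expect_mul_right (p : PMF α) (φ : α → ℝ≥0∞) (c : ℝ≥0∞) :
    (p.expect fun a => φ a * c) = p.expect φ * c := by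
  simp only [expect, ← mul_assoc, ENNReal.tsum_mul_right]

/-- Every probability mass function is the image of one on `ℕ`. -/
theorem exists_nat_map_eq (q : PMF α) : ∃ (p : PMF ℕ) (f : ℕ → α), p.map f = q := by
  classical
  obtain ⟨e, he⟩ := Set.countable_iff_exists_injOn.1 q.support_countable
  have : Nonempty α := ⟨q.support_nonempty.some⟩
  refine ⟨q.map e, Function.invFunOn e q.support, ?_⟩
  rw [map_comp]
  ext a
  rw [map_apply, tsum_eq_single a]
  · by_cases ha : a ∈ q.support
    · rw [if_pos]
      exact (he.leftInvOn_invFunOn ha).symm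
    · have := (q.apply_eq_zero_iff a).2 ha
      simp [this]
  · intro b hb
    by_cases hb' : b ∈ q.support
    · rw [if_neg]
      rw [Function.comp_apply, he.leftInvOn_invFunOn hb']
      exact hb.symm
    · rw [(q.apply_eq_zero_iff b).2 hb']
      simp

end PMF

/-! ### Decision trees as noiseless protocols -/

/-- Deterministic decision trees with leaves labelled by outputs in `α`: at an internal node the
indicated party sends a bit that depends on its input. -/
inductive DecisionTree (X : Type u) (Y : Type v) (α : Type w) where
  | leaf (a : α)
  | alice (f : X → Bool) (c : Bool → DecisionTree X Y α)
  | bob (f : Y → Bool) (c : Bool → DecisionTree X Y α)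

namespace DecisionTree

variable {X : Type u} {Y : Type v} {α : Type w} {β : Type z}

/-- The output on inputs `x, y`. -/
def eval (x : X) (y : Y) : DecisionTree X Y α → α
  | leaf a => a
  | alice f c => (c (f x)).eval x y
  | bob f c => (c (f y)).eval x y

/-- The bits sent on inputs `x, y`. -/
def path (x : X) (y : Y) : DecisionTree X Y α → List Bool
  | leaf _ => []
  | alice f c => f x :: (c (f x)).path x y
  | bob f c => f y :: (c (f y)).path x y

/-- The subtree reached along a history. -/
def walk : DecisionTree X Y α → List Bool → DecisionTree X Y α
  | t, [] => t
  | leaf a, _ :: _ => leaf a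
  | alice _ c, b :: h => (c b).walk h
  | bob _ c, b :: h => (c b).walk h

/-- The noiseless protocol that follows a decision tree. -/
def toProtocol (d : DecisionTree X Y α) : Protocol X Y where
  next h := match d.walk h with
    | leaf _ => none
    | alice _ _ => some .alice
    | bob _ _ => some .bob
  aliceBit x h := match d.walk h with
    | alice f _ => f x
    | _ => false
  bobBit y h := match d.walk h with
    | bob f _ => f y
    | _ => false

/-- The output at the leaf reached along a history, if it is one. -/
def output [Inhabited α] (d : DecisionTree X Y α) (h : List Bool) : α :=
  match d.walk h with
  | leaf a => a
  | _ => default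

theorem sentBit_take_path (x : X) (y : Y) (d : DecisionTree X Y α) (n : ℕ) :
    d.toProtocol.sentBit x y ((d.path x y).take n) = (d.path x y)[n]? := by
  induction d generalizing n with
  | leaf a => simp [path, Protocol.sentBit, toProtocol, walk]
  | alice f c ih =>
    cases n with
    | zero => simp [path, Protocol.sentBit, toProtocol, walk]
    | succ n =>
      have := ih (f x) n
      simpa [path, Protocol.sentBit, toProtocol, walk] using this
  | bob f c ih =>
    cases n with
    | zero => simp [path, Protocol.sentBit, toProtocol, walk]
    | succ n =>
      have := ih (f y) n
      simpa [path, Protocol.sentBit, toProtocol, walk] using this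

theorem run_toProtocol (x : X) (y : Y) (d : DecisionTree X Y α) (n : ℕ) :
    d.toProtocol.run x y n = (d.path x y).take n := by
  induction n with
  | zero => simp [Protocol.run]
  | succ n ih =>
    rw [Protocol.run, ih, sentBit_take_path, List.take_add_one]
    cases (d.path x y)[n]? <;> simp

theorem walk_path (x : X) (y : Y) (d : DecisionTree X Y α) :
    d.walk (d.path x y) = leaf (d.eval x y) := by
  induction d with
  | leaf a => simp [path, walk, eval]
  | alice f c ih => simp [path, walk, eval, ih]
  | bob f c ih => simp [path, walk, eval, ih]

theorem output_path [Inhabited α] (x : X) (y : Y) (d : DecisionTree X Y α) :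
    d.output (d.path x y) = d.eval x y := by
  simp [output, walk_path]

theorem haltsWith_toProtocol (x : X) (y : Y) (d : DecisionTree X Y α) (s : List Bool) :
    d.toProtocol.HaltsWith x y s ↔ s = d.path x y := by
  constructor
  · rintro ⟨h, n, rfl⟩
    rw [run_toProtocol] at h ⊢
    have h1 := sentBit_take_path x y d n
    rw [Protocol.sentBit, h] at h1
    exact List.take_of_length_le (List.getElem?_eq_none_iff.1 h1.symm)
  · rintro rfl
    refine ⟨?_, (d.path x y).length, ?_⟩
    · simp [toProtocol, walk_path]
    · rw [run_toProtocol, List.take_length]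

theorem numBits_toProtocol (x : X) (y : Y) (d : DecisionTree X Y α) :
    d.toProtocol.numBits x y = ((d.path x y).length : ℝ≥0∞) := by
  refine le_antisymm (iSup_le fun n => ?_) (le_iSup_of_le (d.path x y).length ?_)
  · rw [run_toProtocol]
    exact_mod_cast List.length_take_le' n _
  · rw [run_toProtocol, List.take_length]

/-- Replace every leaf by an independent random tree. -/
noncomputable def graft (r : α → PMF (DecisionTree X Y β)) :
    DecisionTree X Y α → PMF (DecisionTree X Y β)
  | leaf a => r a
  | alice f c => (graft r (c false)).bind fun d₀ => (graft r (c true)).map fun d₁ =>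
      alice f fun b => bif b then d₁ else d₀
  | bob f c => (graft r (c false)).bind fun d₀ => (graft r (c true)).map fun d₁ =>
      bob f fun b => bif b then d₁ else d₀

/-- Only the subtree on the path of `x, y` matters; the other is independent and integrates out.
Output and length enter `ψ` together so that one induction yields both the law and the cost. -/
theorem expect_graft (x : X) (y : Y) (r : α → PMF (DecisionTree X Y β)) (d : DecisionTree X Y α)
    (ψ : β → ℕ → ℝ≥0∞) :
    ((graft r d).expect fun t => ψ (t.eval x y) (t.path x y).length) =
      (r (d.eval x y)).expect fun t => ψ (t.eval x y) ((d.path x y).length + (t.path x y).length) := by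
  induction d generalizing ψ with
  | leaf a => simp [graft, eval, path]
  | alice f c ih =>
    simp only [graft, PMF.expect_bind, PMF.expect_map, eval, path]
    cases hb : f x
    · simp only [cond_false, PMF.expect_const, List.length_cons]
      rw [ih false fun b n => ψ b (n + 1)]
      simp only [add_right_comm]
    · simp only [cond_true, PMF.expect_const, List.length_cons]
      rw [ih true fun b n => ψ b (n + 1)]
      simp only [add_right_comm]
  | bob f c ih =>
    simp only [graft, PMF.expect_bind, PMF.expect_map, eval, path]
    cases hb : f y
    · simp only [cond_false, PMF.expect_const, List.length_cons]
      rw [ih false fun b n => ψ b (n + 1)]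
      simp only [add_right_comm]
    · simp only [cond_true, PMF.expect_const, List.length_cons]
      rw [ih true fun b n => ψ b (n + 1)]
      simp only [add_right_comm]

end DecisionTree

/-! ### Sampling with bounded expected communication -/

/-- The input-dependent law `L` can be sampled by a public-coin protocol that exchanges at most
`c x y` bits in expectation; the sample is known to both parties. -/
def Sampleable {X : Type u} {Y : Type v} {α : Type w} (L : X → Y → PMF α) (c : X → Y → ℝ≥0∞) :
    Prop :=
  ∃ q : PMF (DecisionTree X Y α), ∀ x y, q.map (DecisionTree.eval x y) = L x y ∧
    (q.expect fun d => ((d.path x y).length : ℝ≥0∞)) ≤ c x y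

namespace Sampleable

variable {X : Type u} {Y : Type v} {α : Type w} {β : Type z}

theorem mono {L : X → Y → PMF α} {c c' : X → Y → ℝ≥0∞} (h : Sampleable L c)
    (hc : ∀ x y, c x y ≤ c' x y) : Sampleable L c' := by
  obtain ⟨q, hq⟩ := h
  exact ⟨q, fun x y => ⟨(hq x y).1, (hq x y).2.trans (hc x y)⟩⟩

theorem publicCoin (p : PMF α) : Sampleable (fun (_ : X) (_ : Y) => p) fun _ _ => 0 := by
  refine ⟨p.map .leaf, fun x y => ⟨?_, ?_⟩⟩
  · rw [PMF.map_comp]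
    exact PMF.map_id p
  · rw [PMF.expect_map]
    simp [DecisionTree.path]

theorem sendAlice (f : X → Bool) :
    Sampleable (fun (x : X) (_ : Y) => PMF.pure (f x)) fun _ _ => 1 := by
  refine ⟨PMF.pure (.alice f .leaf), fun x y => ⟨?_, ?_⟩⟩
  · simp [PMF.pure_map, DecisionTree.eval]
  · simp [DecisionTree.path]

theorem bind {L : X → Y → PMF α} {c : X → Y → ℝ≥0∞} {L' : α → X → Y → PMF β}
    {c' : α → X → Y → ℝ≥0∞} (h : Sampleable L c) (h' : ∀ a, Sampleable (L' a) (c' a)) :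
    Sampleable (fun x y => (L x y).bind fun a => L' a x y)
      fun x y => c x y + (L x y).expect fun a => c' a x y := by
  classical
  obtain ⟨q, hq⟩ := h
  choose r hr using h'
  refine ⟨q.bind (DecisionTree.graft r), fun x y => ⟨?_, ?_⟩⟩
  · ext b
    have key : ∀ d : DecisionTree X Y α, (DecisionTree.graft r d).map (DecisionTree.eval x y) =
        L' (d.eval x y) x y := by
      intro d
      ext b
      rw [← (hr (d.eval x y) x y).1]
      simp only [← PMF.bind_pure_comp, PMF.bind_apply_eq_expect, Function.comp_apply]
      exact DecisionTree.expect_graft x y r d fun e _ => PMF.pure e b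
    rw [PMF.map_bind]
    beta_reduce
    rw [← (hq x y).1, PMF.bind_map]
    simp only [key, Function.comp_def]
  · rw [PMF.expect_bind]
    have key : ∀ d : DecisionTree X Y α,
        ((DecisionTree.graft r d).expect fun t => ((t.path x y).length : ℝ≥0∞)) ≤
          ((d.path x y).length : ℝ≥0∞) + c' (d.eval x y) x y := by
      intro d
      rw [DecisionTree.expect_graft x y r d fun _ n => (n : ℝ≥0∞)]
      simp only [Nat.cast_add, PMF.expect_add, PMF.expect_const]
      gcongr
      exact (hr _ x y).2
    refine (PMF.expect_mono _ key).trans ?_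
    rw [PMF.expect_add]
    refine add_le_add (hq x y).2 (le_of_eq ?_)
    rw [← (hq x y).1, PMF.expect_map]

/-- A sampleable law on transcripts is the output law of a public-coin protocol. -/
theorem exists_publicCoinProtocol {L : X → Y → PMF (List Bool)} {c : X → Y → ℝ≥0∞}
    (h : Sampleable L c) (C : Bool → PMF Bool) (π : Protocol X Y)
    (hL : ∀ x y t, π.transcriptProb C x y t = L x y t) {B : ℝ≥0∞} (hc : ∀ x y, c x y ≤ B) :
    ∃ φ : PublicCoinProtocol X Y, φ.Simulates C π ∧ φ.avgCC ≤ B := by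
  classical
  obtain ⟨q, hq⟩ := h
  -- Trees live in an arbitrary universe and carry no Borel structure; the countable support lets
  -- the shared randomness be a natural number.
  obtain ⟨p, D, rfl⟩ := q.exists_nat_map_eq
  refine ⟨{ Ω := ℕ, μ := p.toMeasure, prot := fun n => (D n).toProtocol
            measurableSet_next := fun _ _ => .of_discrete
            measurableSet_aliceBit := fun _ _ _ => .of_discrete
            measurableSet_bobBit := fun _ _ _ => .of_discrete },
    ⟨fun n => (D n).output, fun _ _ => MeasurableSet.of_discrete (α := ℕ), fun x y t => ?_⟩,
    iSup₂_le fun x y => ?_⟩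
  · have hset : {n | ∃ s, (D n).toProtocol.HaltsWith x y s ∧ (D n).output s = t} =
        {n | (D n).eval x y = t} := by
      ext n
      simp [DecisionTree.haltsWith_toProtocol, DecisionTree.output_path]
    rw [hL, ← (hq x y).1, PMF.map_comp, PMF.map_apply]
    change p.toMeasure {n | ∃ s, (D n).toProtocol.HaltsWith x y s ∧ (D n).output s = t} = _
    rw [hset, PMF.toMeasure_apply _ .of_discrete]
    refine tsum_congr fun n => ?_
    simp [Set.indicator_apply, eq_comm]
  · change ∫⁻ n, (D n).toProtocol.numBits x y ∂p.toMeasure ≤ B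
    rw [MeasureTheory.lintegral_countable']
    refine le_trans (le_of_eq ?_) ((hq x y).2.trans (hc x y))
    rw [PMF.expect_map]
    refine tsum_congr fun n => ?_
    rw [DecisionTree.numBits_toProtocol, PMF.toMeasure_apply_singleton _ _ .of_discrete, mul_comm]

end Sampleable

/-! ### Input-dependent coins and announced integers -/

namespace PMF

theorem bool_true_add_false (p : PMF Bool) : p true + p false = 1 := by
  have := p.tsum_coe
  rwa [tsum_bool, add_comm] at this

theorem bool_ext {p q : PMF Bool} (h : p true = q true) : p = q := by
  ext b
  cases b
  · have h1 := p.bool_true_add_false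
    have h2 := q.bool_true_add_false
    rw [← h2, h] at h1
    exact (ENNReal.add_right_inj (q.apply_ne_top true)).1 h1
  · exact h

/-- The number of failures before the first success of a fair coin. -/
noncomputable def fairGeometric : PMF ℕ :=
  ⟨fun n => 2⁻¹ ^ (n + 1), by
    have h : ∑' n : ℕ, (2⁻¹ : ℝ≥0∞) ^ (n + 1) = 1 := by
      rw [ENNReal.tsum_geometric_add_one, ENNReal.one_sub_inv_two, inv_inv]
      exact ENNReal.inv_mul_cancel (by simp) (by simp)
    exact h ▸ ENNReal.summable.hasSum⟩

theorem fairGeometric_apply (n : ℕ) : fairGeometric n = 2⁻¹ ^ (n + 1) := rfl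

/-- Reading a random binary digit of a number produces a coin with that bias. -/
theorem exists_digits (r : PMF Bool) :
    ∃ d : ℕ → Bool, (fairGeometric.map d) = r := by
  have hmem : (r true).toReal ∈ Set.Icc (0 : ℝ) 1 :=
    ⟨ENNReal.toReal_nonneg, ENNReal.toReal_le_of_le_ofReal zero_le_one (by simpa using r.coe_le_one true)⟩
  obtain ⟨d, -, hd⟩ := Real.ofDigits_SurjOn (b := 2) (by norm_num) hmem
  refine ⟨fun n => decide (d n = 1), bool_ext ?_⟩
  rw [← ENNReal.ofReal_toReal (r.apply_ne_top true), ← hd, Real.ofDigits,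
    ENNReal.ofReal_tsum_of_nonneg (fun _ => Real.ofDigitsTerm_nonneg) Real.summable_ofDigitsTerm,
    map_apply]
  refine tsum_congr fun n => ?_
  rw [fairGeometric_apply, Real.ofDigitsTerm]
  have h2 : ENNReal.ofReal ((2 ^ (n + 1))⁻¹) = 2⁻¹ ^ (n + 1) := by
    rw [← inv_pow, ENNReal.ofReal_pow (by norm_num), ENNReal.ofReal_inv_of_pos (by norm_num)]
    norm_num
  rcases Fin.exists_fin_two.1 ⟨d n, rfl⟩ with h | h
  · simp [h]
  · simpa [h] using h2.symm

/-- A biased coin. -/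
noncomputable def coin (q : ℝ≥0∞) : PMF Bool :=
  PMF.ofFintype (fun b => bif b then min q 1 else 1 - min q 1) (by
    simp [add_tsub_cancel_of_le])

theorem expect_coin {q : ℝ≥0∞} (hq : q ≤ 1) (φ : Bool → ℝ≥0∞) :
    (coin q).expect φ = q * φ true + (1 - q) * φ false := by
  unfold expect
  rw [tsum_bool, add_comm]
  simp [coin, min_eq_left hq]

end PMF

namespace DecisionTree

variable {X : Type u} {Y : Type v} {α : Type w}

/-- Exchange the roles of the parties. -/
def swap : DecisionTree X Y α → DecisionTree Y X α
  | leaf a => leaf a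
  | alice f c => bob f fun b => (c b).swap
  | bob f c => alice f fun b => (c b).swap

theorem eval_swap (x : X) (y : Y) (d : DecisionTree X Y α) : d.swap.eval y x = d.eval x y := by
  induction d with
  | leaf a => rfl
  | alice f c ih => simp [swap, eval, ih]
  | bob f c ih => simp [swap, eval, ih]

theorem path_swap (x : X) (y : Y) (d : DecisionTree X Y α) : d.swap.path y x = d.path x y := by
  induction d with
  | leaf a => rfl
  | alice f c ih => simp [swap, path, ih]
  | bob f c ih => simp [swap, path, ih]

end DecisionTree

namespace Sampleable

variable {X : Type u} {Y : Type v} {α : Type w} {β : Type z}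

theorem swap {L : X → Y → PMF α} {c : X → Y → ℝ≥0∞} (h : Sampleable L c) :
    Sampleable (fun y x => L x y) fun y x => c x y := by
  obtain ⟨q, hq⟩ := h
  refine ⟨q.map DecisionTree.swap, fun y x => ⟨?_, ?_⟩⟩
  · beta_reduce
    rw [PMF.map_comp, ← (hq x y).1]
    congr 1
    ext d
    exact DecisionTree.eval_swap x y d
  · rw [PMF.expect_map]
    simpa only [DecisionTree.path_swap] using (hq x y).2

theorem congr {L L' : X → Y → PMF α} {c : X → Y → ℝ≥0∞} (h : Sampleable L c)
    (hL : ∀ x y, L x y = L' x y) : Sampleable L' c := by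
  obtain rfl : L = L' := funext₂ hL
  exact h

theorem pure (a : α) : Sampleable (fun (_ : X) (_ : Y) => PMF.pure a) fun _ _ => 0 :=
  publicCoin _

/-- Alice flips a coin whose bias depends on her input. -/
theorem coinAlice (r : X → PMF Bool) : Sampleable (fun (x : X) (_ : Y) => r x) fun _ _ => 1 := by
  choose d hd using fun x => (r x).exists_digits
  -- Public coins choose which binary digit of the bias is read, and Alice sends that digit: one
  -- bit, however fine the bias.
  refine ((bind (publicCoin PMF.fairGeometric) fun n => sendAlice fun x => d x n).congr
    fun x y => ?_).mono fun x y => ?_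
  · rw [← hd x]
    rfl
  · simp

theorem coinBob (r : Y → PMF Bool) : Sampleable (fun (_ : X) (y : Y) => r y) fun _ _ => 1 :=
  (coinAlice r).swap

/-- Alice announces a natural number, at a cost logarithmic in its value. -/
theorem sendNatAlice (m : ℕ) (f : X → ℕ) (hf : ∀ x, f x < 2 ^ m) :
    Sampleable (fun (x : X) (_ : Y) => PMF.pure (f x)) fun x _ => 1 + 2 * ((f x).size : ℝ≥0∞) := by
  induction m generalizing f with
  | zero =>
    have h0 : ∀ x, f x = 0 := fun x => by simpa using hf x
    simpa [h0] using (pure (X := X) (Y := Y) 0).mono fun _ _ => zero_le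
  | succ m ih =>
    have ih' := ih (fun x => f x / 2) fun x => by
      have := hf x
      rw [pow_succ] at this
      omega
    -- A flag tells whether the number is zero; if not, the lowest binary digit follows and then
    -- half of the number. This is two bits per digit and a final flag.
    refine ((bind (sendAlice fun x => decide (f x = 0)) (L' := fun z x _ =>
        PMF.pure (if z then 0 else f x))
      (c' := fun z x _ => if z then 0 else 1 + (1 + 2 * ((f x / 2).size : ℝ≥0∞))) fun z => ?_).congr
      fun x y => ?_).mono fun x y => ?_
    · cases z
      · refine ((bind (sendAlice fun x => decide (f x % 2 = 1)) (L' := fun z x _ =>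
          PMF.pure (2 * (f x / 2) + if z then 1 else 0))
          (c' := fun z x _ => 1 + 2 * ((f x / 2).size : ℝ≥0∞)) fun z => ?_).congr
          fun x y => ?_).mono fun x y => ?_
        · refine ((bind ih' fun n => pure (2 * n + if z then 1 else 0)).congr
            fun x y => ?_).mono fun x y => ?_
          · rw [PMF.pure_bind]
          · simp
        · rw [PMF.pure_bind]
          simp only [Bool.false_eq_true, if_false, decide_eq_true_eq]
          congr 1
          split_ifs <;> omega
        · simp
      · simpa using pure (X := X) (Y := Y) 0
    · rw [PMF.pure_bind]
      congr 1
      by_cases h : f x = 0 <;> simp [h]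
    · rw [PMF.expect_pure]
      by_cases h : f x = 0
      · simp [h]
      · have : (f x).size = (f x / 2).size + 1 := by
          conv_lhs => rw [← Nat.bit_bodd_div2 (f x), Nat.size_bit (by rwa [Nat.bit_bodd_div2]),
            Nat.div2_val]
        rw [this]
        simp only [h, decide_false, Bool.false_eq_true, if_false]
        push_cast
        apply le_of_eq
        ring

end Sampleable

/-! ### Stopping times on uniform bit strings -/

/-- Uniformly random bit strings of length `n`. -/
noncomputable def unifBits : ℕ → PMF (List Bool)
  | 0 => PMF.pure []
  | n + 1 => (PMF.coin 2⁻¹).bind fun b => (unifBits n).map (b :: ·)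

theorem expect_unifBits_zero (φ : List Bool → ℝ≥0∞) : (unifBits 0).expect φ = φ [] := by
  simp [unifBits]

theorem expect_unifBits_succ (n : ℕ) (φ : List Bool → ℝ≥0∞) :
    (unifBits (n + 1)).expect φ =
      2⁻¹ * ((unifBits n).expect (fun t => φ (true :: t)) +
        (unifBits n).expect fun t => φ (false :: t)) := by
  rw [unifBits, PMF.expect_bind, PMF.expect_coin (by norm_num), ENNReal.one_sub_inv_two,
    PMF.expect_map, PMF.expect_map, mul_add]

theorem expect_unifBits_mono {n : ℕ} {φ ψ : List Bool → ℝ≥0∞}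
    (h : ∀ t, t.length = n → φ t ≤ ψ t) : (unifBits n).expect φ ≤ (unifBits n).expect ψ := by
  induction n generalizing φ ψ with
  | zero => simpa [expect_unifBits_zero] using h [] rfl
  | succ n ih =>
    rw [expect_unifBits_succ, expect_unifBits_succ]
    gcongr 2⁻¹ * (?_ + ?_)
    · exact ih fun t ht => h _ (by simp [ht])
    · exact ih fun t ht => h _ (by simp [ht])

open Classical in
/-- The first index at which the prefix of a bit string satisfies `C`, or else its length. -/
noncomputable def stopTime (C : List Bool → Prop) : List Bool → ℕ
  | [] => 0
  | b :: t => if C [] then 0 else stopTime (fun u => C (b :: u)) t + 1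

theorem stopTime_le_length (C : List Bool → Prop) (t : List Bool) : stopTime C t ≤ t.length := by
  induction t generalizing C with
  | nil => simp [stopTime]
  | cons b t ih =>
    rw [stopTime]
    split_ifs
    · simp
    · simpa using ih _

theorem not_of_lt_stopTime {C : List Bool → Prop} {t : List Bool} {i : ℕ}
    (h : i < stopTime C t) : ¬ C (t.take i) := by
  induction t generalizing C i with
  | nil => simp [stopTime] at h
  | cons b t ih =>
    rw [stopTime] at h
    split_ifs at h with h0
    · simp at h
    · cases i with
      | zero => simpa using h0
      | succ i => simpa using ih (C := fun u => C (b :: u)) (i := i) (by omega)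

theorem take_stopTime {C : List Bool → Prop} {t : List Bool} (h : stopTime C t < t.length) :
    C (t.take (stopTime C t)) := by
  induction t generalizing C with
  | nil => simp at h
  | cons b t ih =>
    rw [stopTime] at h ⊢
    split_ifs at h ⊢ with h0
    · simpa using h0
    · simpa using ih (C := fun u => C (b :: u)) (by simpa using h)

theorem stopTime_or (C D : List Bool → Prop) (t : List Bool) :
    stopTime (fun u => C u ∨ D u) t = min (stopTime C t) (stopTime D t) := by
  induction t generalizing C D with
  | nil => simp [stopTime]
  | cons b t ih =>
    simp only [stopTime]
    by_cases h1 : C [] <;> by_cases h2 : D [] <;> simp [h1, h2, ih]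

/-- Optional stopping. -/
theorem expect_take_stopTime (n : ℕ) (C : List Bool → Prop) (φ : List Bool → ℝ≥0∞)
    (h : ∀ u, φ u = 2⁻¹ * (φ (u ++ [true]) + φ (u ++ [false]))) :
    ((unifBits n).expect fun t => φ (t.take (stopTime C t))) = φ [] := by
  induction n generalizing C φ with
  | zero => simp [expect_unifBits_zero]
  | succ n ih =>
    rw [expect_unifBits_succ]
    by_cases h0 : C []
    · simp [stopTime, h0, ENNReal.inv_two_add_inv_two, mul_add, ← add_mul]
    · simp only [stopTime, h0, if_false, List.take_succ_cons]
      rw [ih (fun u => C (true :: u)) (fun u => φ (true :: u)) fun u => h _,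
        ih (fun u => C (false :: u)) (fun u => φ (false :: u)) fun u => h _, h []]
      rfl

/-! ### Likelihood ratios and their moments -/

/-- The product of the factors `γ` along a bit string. -/
noncomputable def prodWeight (γ : List Bool → Bool → ℝ≥0∞) : List Bool → ℝ≥0∞
  | [] => 1
  | b :: u => γ [] b * prodWeight (fun v => γ (b :: v)) u

theorem prodWeight_append (γ : List Bool → Bool → ℝ≥0∞) (u v : List Bool) :
    prodWeight γ (u ++ v) = prodWeight γ u * prodWeight (fun w => γ (u ++ w)) v := by
  induction u generalizing γ with
  | nil => simp [prodWeight]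
  | cons b u ih =>
    simp only [List.cons_append, prodWeight, ih, mul_assoc]

theorem prodWeight_concat (γ : List Bool → Bool → ℝ≥0∞) (u : List Bool) (b : Bool) :
    prodWeight γ (u ++ [b]) = prodWeight γ u * γ u b := by
  simp [prodWeight_append, prodWeight]

/-- Factors that are either trivial or twice the transition probabilities of a channel with
crossover probability `1 / 2 - ε`. -/
def IsTilt (ε : ℝ) (γ : List Bool → Bool → ℝ≥0∞) : Prop :=
  ∀ u, (∀ b, γ u b = 1) ∨
    ∃ b, γ u b = ENNReal.ofReal (1 + 2 * ε) ∧ γ u (!b) = ENNReal.ofReal (1 - 2 * ε)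

namespace IsTilt

variable {ε : ℝ} {γ : List Bool → Bool → ℝ≥0∞}

theorem comp (h : IsTilt ε γ) (f : List Bool → List Bool) : IsTilt ε fun u => γ (f u) :=
  fun u => h (f u)

theorem le_two (h : IsTilt ε γ) (h0 : 0 ≤ ε) (h1 : ε ≤ 1 / 2) (u : List Bool) (b : Bool) :
    γ u b ≤ 2 := by
  rcases h u with h | ⟨c, hc, hc'⟩
  · rw [h b]; norm_num
  · have key : ∀ r : ℝ, r ≤ 2 → ENNReal.ofReal r ≤ 2 := fun r hr => by
      simpa using ENNReal.ofReal_le_ofReal hr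
    rcases Bool.eq_or_eq_not b c with rfl | rfl
    · rw [hc]; exact key _ (by linarith)
    · rw [hc']; exact key _ (by linarith)

/-- Since `1 ± 2ε ≤ exp (± 2ε)`, the average is at most `cosh (2εl) ≤ exp ((2εl) ^ 2 / 2)`. -/
theorem moment_le (h : IsTilt ε γ) (h0 : 0 ≤ ε) (h1 : ε ≤ 1 / 2) (l : ℕ) (u : List Bool) :
    2⁻¹ * (γ u true ^ l + γ u false ^ l) ≤ ENNReal.ofReal (Real.exp (2 * ε ^ 2 * l ^ 2)) := by
  rcases h u with h | ⟨c, hc, hc'⟩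
  · rw [h, h, one_pow, one_add_one_eq_two, ENNReal.inv_mul_cancel (by simp) (by simp),
      ENNReal.one_le_ofReal]
    exact Real.one_le_exp (by positivity)
  · have hsum : γ u true ^ l + γ u false ^ l =
        ENNReal.ofReal (1 + 2 * ε) ^ l + ENNReal.ofReal (1 - 2 * ε) ^ l := by
      cases c
      · rw [add_comm, hc, ← hc']; rfl
      · rw [hc, ← hc']; rfl
    have hpos : 0 ≤ 1 - 2 * ε := by linarith
    rw [hsum, ← ENNReal.ofReal_pow (by linarith), ← ENNReal.ofReal_pow hpos,
      ← ENNReal.ofReal_add (by positivity) (by positivity),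
      show (2⁻¹ : ℝ≥0∞) = ENNReal.ofReal 2⁻¹ by
        rw [ENNReal.ofReal_inv_of_pos (by norm_num)]; norm_num,
      ← ENNReal.ofReal_mul (by norm_num)]
    apply ENNReal.ofReal_le_ofReal
    have e1 : (1 + 2 * ε) ^ l ≤ Real.exp (2 * ε * l) := by
      rw [mul_comm (2 * ε), Real.exp_nat_mul]
      gcongr
      linarith [Real.add_one_le_exp (2 * ε)]
    have e2 : (1 - 2 * ε) ^ l ≤ Real.exp (-(2 * ε * l)) := by
      rw [show -(2 * ε * l) = l * (-(2 * ε)) by ring, Real.exp_nat_mul]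
      gcongr
      linarith [Real.add_one_le_exp (-(2 * ε))]
    have e3 := Real.cosh_le_exp_half_sq (2 * ε * l)
    rw [Real.cosh_eq, show (2 * ε * l) ^ 2 / 2 = 2 * ε ^ 2 * l ^ 2 by ring] at e3
    linarith

/-- The first `i` bits are averaged out, and each later bit contributes one factor from `moment_le`,
whatever the past. A segment running past the end only has fewer factors, which is harmless because
the bound is at least 1. -/
theorem expect_segment_le (h : IsTilt ε γ) (h0 : 0 ≤ ε) (h1 : ε ≤ 1 / 2) (l N i n : ℕ) :
    ((unifBits N).expect fun t =>
      prodWeight (fun w => γ (t.take i ++ w)) ((t.drop i).take n) ^ l) ≤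
      ENNReal.ofReal (Real.exp (2 * ε ^ 2 * l ^ 2)) ^ n := by
  have hone : (1 : ℝ≥0∞) ≤ ENNReal.ofReal (Real.exp (2 * ε ^ 2 * l ^ 2)) := by
    rw [ENNReal.one_le_ofReal]
    exact Real.one_le_exp (by positivity)
  induction N generalizing γ i n with
  | zero => simpa [expect_unifBits_zero, prodWeight] using one_le_pow₀ hone
  | succ N ih =>
    cases i with
    | succ i =>
      rw [expect_unifBits_succ]
      simp only [List.take_succ_cons, List.drop_succ_cons, List.cons_append]
      calc _ ≤ 2⁻¹ * (ENNReal.ofReal (Real.exp (2 * ε ^ 2 * l ^ 2)) ^ n +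
            ENNReal.ofReal (Real.exp (2 * ε ^ 2 * l ^ 2)) ^ n) := by
            gcongr
            · exact ih (h.comp (true :: ·)) i n
            · exact ih (h.comp (false :: ·)) i n
        _ = _ := by rw [mul_add, ← add_mul, ENNReal.inv_two_add_inv_two, one_mul]
    | zero =>
      cases n with
      | zero => simp [prodWeight]
      | succ n =>
        rw [expect_unifBits_succ]
        simp only [List.take_zero, List.drop_zero, List.nil_append, List.take_succ_cons,
          prodWeight, mul_pow]
        have hb : ∀ b : Bool, ((unifBits N).expect fun t =>
            γ [] b ^ l * prodWeight (fun w => γ (b :: w)) (t.take n) ^ l) ≤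
            γ [] b ^ l * ENNReal.ofReal (Real.exp (2 * ε ^ 2 * l ^ 2)) ^ n := by
          intro b
          simp only [mul_comm (γ [] b ^ l)]
          rw [PMF.expect_mul_right]
          exact mul_le_mul_left (by simpa using ih (h.comp (b :: ·)) 0 n) _
        calc _ ≤ 2⁻¹ * (γ [] true ^ l * ENNReal.ofReal (Real.exp (2 * ε ^ 2 * l ^ 2)) ^ n +
              γ [] false ^ l * ENNReal.ofReal (Real.exp (2 * ε ^ 2 * l ^ 2)) ^ n) := by
              exact mul_le_mul_right (add_le_add (hb true) (hb false)) _
          _ = 2⁻¹ * (γ [] true ^ l + γ [] false ^ l) *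
              ENNReal.ofReal (Real.exp (2 * ε ^ 2 * l ^ 2)) ^ n := by ring
          _ ≤ _ := by
              rw [pow_succ' _ n]
              gcongr
              exact h.moment_le h0 h1 l []

end IsTilt

/-! ### Grid levels, barriers and the cost of a stopping time -/

/-- The least `j` such that `i` lies on the grid of mesh `16 ^ (m - j)`. -/
noncomputable def gridLevel (m i : ℕ) : ℕ := sInf {j | 16 ^ (m - j) ∣ i}

theorem pow_gridLevel_dvd (m i : ℕ) : 16 ^ (m - gridLevel m i) ∣ i :=
  Nat.sInf_mem (s := {j | 16 ^ (m - j) ∣ i}) ⟨m, by simp⟩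

theorem gridLevel_le_of_dvd {m i j : ℕ} (h : 16 ^ (m - j) ∣ i) : gridLevel m i ≤ j :=
  Nat.sInf_le h

theorem gridLevel_le (m i : ℕ) : gridLevel m i ≤ m := gridLevel_le_of_dvd (by simp)

/-- The barrier at grid level `j`; it increases with `j`. -/
noncomputable def barrier (j : ℕ) : ℝ≥0∞ := ENNReal.ofReal (Real.exp (2 - (1 / 2) ^ j))

theorem barrier_mono : Monotone barrier := by
  intro i j h
  apply ENNReal.ofReal_le_ofReal
  rw [Real.exp_le_exp]
  have : ((1 : ℝ) / 2) ^ j ≤ (1 / 2) ^ i := pow_le_pow_of_le_one (by norm_num) (by norm_num) h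
  linarith

theorem barrier_le (j : ℕ) : barrier j ≤ 8 := by
  have h : Real.exp (2 - (1 / 2) ^ j) ≤ 8 := by
    calc Real.exp (2 - (1 / 2) ^ j) ≤ Real.exp (1 + 1) := by
          rw [Real.exp_le_exp]
          have : (0 : ℝ) < (1 / 2) ^ j := by positivity
          linarith
      _ = Real.exp 1 * Real.exp 1 := Real.exp_add _ _
      _ ≤ 2.7182818286 * 2.7182818286 := by
          gcongr <;> exact Real.exp_one_lt_d9.le
      _ ≤ 8 := by norm_num
  simpa [barrier] using ENNReal.ofReal_le_ofReal h

theorem barrier_succ (j : ℕ) :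
    barrier (j + 1) = barrier j * ENNReal.ofReal (Real.exp ((1 / 2) ^ (j + 1))) := by
  rw [barrier, barrier, ← ENNReal.ofReal_mul (Real.exp_pos _).le, ← Real.exp_add]
  congr 2
  ring

/-- A party stops when its likelihood ratio reaches the barrier of the current grid level. -/
def Exceeds (m : ℕ) (γ : List Bool → Bool → ℝ≥0∞) (u : List Bool) : Prop :=
  barrier (gridLevel m u.length) ≤ prodWeight γ u

theorem not_exceeds_nil (m : ℕ) (γ : List Bool → Bool → ℝ≥0∞) : ¬ Exceeds m γ [] := by
  have h0 : gridLevel m 0 = 0 := Nat.le_zero.1 (gridLevel_le_of_dvd (by simp))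
  simp [Exceeds, prodWeight, h0, barrier, ENNReal.ofReal_le_one, Real.exp_le_one_iff]

namespace IsTilt

variable {ε : ℝ} {γ : List Bool → Bool → ℝ≥0∞}

/-- One step before, the barrier, at most 8, had not been reached, and a single factor is at most 2.
-/
theorem prodWeight_take_le (h : IsTilt ε γ) (h0 : 0 ≤ ε) (h1 : ε ≤ 1 / 2) (m : ℕ)
    (t : List Bool) {i : ℕ} (hi : i ≤ stopTime (Exceeds m γ) t) :
    prodWeight γ (t.take i) ≤ 16 := by
  cases i with
  | zero => simp [prodWeight]
  | succ i =>
    have hlt := not_of_lt_stopTime (Nat.lt_of_succ_le hi)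
    have hlen := stopTime_le_length (Exceeds m γ) t
    rw [Exceeds, not_le] at hlt
    rw [List.take_add_one, List.getElem?_eq_getElem (by omega), Option.toList_some,
      prodWeight_concat]
    calc _ ≤ (8 : ℝ≥0∞) * 2 := by
          gcongr
          · exact hlt.le.trans (barrier_le _)
          · exact h.le_two h0 h1 _ _
      _ = 16 := by norm_num

open Classical in
-- The coarser grid point just before the stopping time did not stop, so the ratio there was below
-- `barrier j`; the segment in between gained at least `exp (2 ^ (-(j + 1)))`. The summand of that
-- segment is then at least 1. The sum over all candidate times `q` plays the role of a union bound,
-- with `l` left free for Markov's inequality.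
theorem level_indicator_le (m j : ℕ) (hj : j < m) (t : List Bool) (ht : t.length = 16 ^ m) (l : ℕ)
    (hl : gridLevel m (stopTime (Exceeds m γ) t) = j + 1) :
    1 ≤ ∑ q ∈ Finset.range (16 ^ (j + 1)),
      (prodWeight (fun w => γ (t.take (q / 16 * 16 ^ (m - j)) ++ w))
        ((t.drop (q / 16 * 16 ^ (m - j))).take (q % 16 * 16 ^ (m - (j + 1)))) ^ l) *
        ENNReal.ofReal (Real.exp (-(1 / 2) ^ (j + 1))) ^ l := by
  set σ := stopTime (Exceeds m γ) t with hσ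
  obtain ⟨q, hq⟩ := pow_gridLevel_dvd m σ
  rw [hl] at hq
  have hpow : 16 ^ (m - j) = 16 * 16 ^ (m - (j + 1)) := by
    rw [← pow_succ', show m - (j + 1) + 1 = m - j by omega]
  have hndvd : ¬ 16 ^ (m - j) ∣ σ := fun hd => by
    have := gridLevel_le_of_dvd hd
    omega
  have hσlt : σ < 16 ^ m := by
    -- The end of the block lies on every grid, so a time off the mesh `16 ^ (m - j)` is a genuine
    -- stop.
    refine lt_of_le_of_ne (ht ▸ stopTime_le_length _ _) fun h => hndvd ?_
    rw [h]
    exact pow_dvd_pow _ (by omega)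
  have hqlt : q < 16 ^ (j + 1) := by
    have : 16 ^ m = 16 ^ (m - (j + 1)) * 16 ^ (j + 1) := by
      rw [← pow_add]; congr 1; omega
    rw [hq, this] at hσlt
    exact lt_of_mul_lt_mul_left hσlt (Nat.zero_le _)
  have hsplit : σ = q / 16 * 16 ^ (m - j) + q % 16 * 16 ^ (m - (j + 1)) := by
    rw [hq, hpow, ← mul_assoc, ← add_mul, mul_comm (q / 16), Nat.div_add_mod, mul_comm]
  set i := q / 16 * 16 ^ (m - j) with hi
  have hilt : i < σ := by
    refine lt_of_le_of_ne (by omega) fun h => hndvd ?_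
    rw [← h]
    exact Dvd.intro_left _ rfl
  have hno := not_of_lt_stopTime hilt
  have hyes : Exceeds m γ (t.take σ) := take_stopTime (by rw [ht]; exact hσlt)
  rw [Exceeds, List.length_take, min_eq_left (by omega)] at hno hyes
  rw [hl] at hyes
  rw [not_le] at hno
  have hno' : prodWeight γ (t.take i) ≤ barrier j :=
    hno.le.trans (barrier_mono (gridLevel_le_of_dvd (Dvd.intro_left _ rfl)))
  rw [hsplit, List.take_add, prodWeight_append, barrier_succ] at hyes
  set W := prodWeight (fun w => γ (t.take i ++ w)) ((t.drop i).take (q % 16 * 16 ^ (m - (j + 1))))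
    with hW
  have hWge : ENNReal.ofReal (Real.exp ((1 / 2) ^ (j + 1))) ≤ W := by
    refine (ENNReal.mul_le_mul_iff_right (a := barrier j) ?_ ?_).1
      (hyes.trans (mul_le_mul_left hno' _))
    · simp [barrier, Real.exp_pos]
    · simp [barrier]
  refine le_trans ?_ (Finset.single_le_sum (f := fun q =>
      (prodWeight (fun w => γ (t.take (q / 16 * 16 ^ (m - j)) ++ w))
        ((t.drop (q / 16 * 16 ^ (m - j))).take (q % 16 * 16 ^ (m - (j + 1)))) ^ l) *
        ENNReal.ofReal (Real.exp (-(1 / 2) ^ (j + 1))) ^ l)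
      (fun _ _ => zero_le) (Finset.mem_range.2 hqlt))
  change 1 ≤ W ^ l * _
  rw [← mul_pow]
  refine one_le_pow₀ ?_
  calc (1 : ℝ≥0∞) = ENNReal.ofReal (Real.exp ((1 / 2) ^ (j + 1))) *
        ENNReal.ofReal (Real.exp (-(1 / 2) ^ (j + 1))) := by
        rw [← ENNReal.ofReal_mul (Real.exp_pos _).le, ← Real.exp_add]; simp
    _ ≤ _ := by gcongr

end IsTilt

theorem PMF.expect_finset_sum {α : Type u} {ι : Type v} (p : PMF α) (s : Finset ι)
    (φ : ι → α → ℝ≥0∞) :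
    (p.expect fun a => ∑ i ∈ s, φ i a) = ∑ i ∈ s, p.expect (φ i) := by
  classical
  induction s using Finset.induction_on with
  | empty => simp
  | insert i s hi ih => simp only [Finset.sum_insert hi, PMF.expect_add, ih]

/-- With moment order `l = 16 · 4 ^ (j + 1)`, the growth exponent `n · 2 ε ^ 2 l ^ 2` is at most
`8192 ε ^ 2 16 ^ m ≤ 1`, while the required gain contributes `-16 · 2 ^ (j + 1) ≤ -16 (j + 2)`. The
total is at most `-(15 + 16 (j + 1))`, and `e⁻¹ ≤ 1 / 2`. -/
theorem exp_barrier_tail_le {ε : ℝ} {m j : ℕ} (hj : j < m) (hm : 8192 * ε ^ 2 * 16 ^ m ≤ 1)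
    {n : ℕ} (hn : n ≤ 16 * 16 ^ (m - (j + 1))) :
    ENNReal.ofReal (Real.exp (2 * ε ^ 2 * (16 * 4 ^ (j + 1) : ℕ) ^ 2)) ^ n *
      ENNReal.ofReal (Real.exp (-(1 / 2) ^ (j + 1))) ^ (16 * 4 ^ (j + 1)) ≤
      2⁻¹ ^ (15 + 16 * (j + 1)) := by
  rw [← ENNReal.ofReal_pow (Real.exp_pos _).le, ← ENNReal.ofReal_pow (Real.exp_pos _).le,
    ← ENNReal.ofReal_mul (by positivity), ← Real.exp_nat_mul, ← Real.exp_nat_mul, ← Real.exp_add]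
  have h2 : (2⁻¹ : ℝ≥0∞) ^ (15 + 16 * (j + 1)) = ENNReal.ofReal (2⁻¹ ^ (15 + 16 * (j + 1))) := by
    rw [ENNReal.ofReal_pow (by norm_num), ENNReal.ofReal_inv_of_pos (by norm_num)]
    norm_num
  rw [h2]
  apply ENNReal.ofReal_le_ofReal
  have hinv : Real.exp (-1) ≤ 2⁻¹ := by
    rw [Real.exp_neg]
    gcongr
    linarith [Real.add_one_le_exp 1]
  calc _ ≤ Real.exp ((15 + 16 * (j + 1) : ℕ) * (-1)) := by
        rw [Real.exp_le_exp]
        have hn' : (n : ℝ) ≤ 16 * 16 ^ (m - (j + 1)) := by exact_mod_cast hn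
        have h16 : (16 : ℝ) ^ (m - (j + 1)) * 16 ^ (j + 1) = 16 ^ m := by
          rw [← pow_add]; congr 1; omega
        have h44 : ((4 : ℝ) ^ (j + 1)) ^ 2 = 16 ^ (j + 1) := by
          rw [← pow_mul, mul_comm, pow_mul]; norm_num
        have h42 : (4 : ℝ) ^ (j + 1) * (1 / 2) ^ (j + 1) = 2 ^ (j + 1) := by
          rw [← mul_pow]; norm_num
        have h1 : (n : ℝ) * (2 * ε ^ 2 * (16 * 4 ^ (j + 1) : ℕ) ^ 2) ≤ 1 := by
          push_cast
          calc (n : ℝ) * (2 * ε ^ 2 * (16 * 4 ^ (j + 1)) ^ 2)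
              ≤ (16 * 16 ^ (m - (j + 1))) * (2 * ε ^ 2 * (16 * 4 ^ (j + 1)) ^ 2) := by gcongr
            _ = 8192 * ε ^ 2 * (16 ^ (m - (j + 1)) * 16 ^ (j + 1)) := by
              rw [mul_pow, h44]; ring
            _ ≤ 1 := by rw [h16]; exact hm
        have h3 : ((j + 1 : ℕ) : ℝ) + 1 ≤ 2 ^ (j + 1) := by
          exact_mod_cast Nat.lt_two_pow_self (n := j + 1)
        have h5 : ((16 * 4 ^ (j + 1) : ℕ) : ℝ) * (-(1 / 2) ^ (j + 1)) = -(16 * 2 ^ (j + 1)) := by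
          push_cast
          rw [← h42]; ring
        rw [h5]
        push_cast at h1 h3 ⊢
        linarith
    _ = Real.exp (-1) ^ (15 + 16 * (j + 1)) := Real.exp_nat_mul _ _
    _ ≤ _ := by gcongr

/-- Stopping away from the coarse grid is rare. -/
theorem IsTilt.expect_gridLevel_le {ε : ℝ} {γ : List Bool → Bool → ℝ≥0∞} (h : IsTilt ε γ)
    (h0 : 0 ≤ ε) (h1 : ε ≤ 1 / 2) {m : ℕ} (hm : m ≠ 0 → 8192 * ε ^ 2 * 16 ^ m ≤ 1) :
    ((unifBits (16 ^ m)).expect fun t => (gridLevel m (stopTime (Exceeds m γ) t) : ℝ≥0∞)) ≤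
      2⁻¹ ^ 10 := by
  set S : ℕ → ℕ → List Bool → ℝ≥0∞ := fun j q t =>
      (prodWeight (fun w => γ (t.take (q / 16 * 16 ^ (m - j)) ++ w))
        ((t.drop (q / 16 * 16 ^ (m - j))).take (q % 16 * 16 ^ (m - (j + 1)))) ^ (16 * 4 ^ (j + 1))) *
        ENNReal.ofReal (Real.exp (-(1 / 2) ^ (j + 1))) ^ (16 * 4 ^ (j + 1)) with hS
  have hpt : ∀ t : List Bool, t.length = 16 ^ m →
      (gridLevel m (stopTime (Exceeds m γ) t) : ℝ≥0∞) ≤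
        ∑ j ∈ Finset.range m, ∑ q ∈ Finset.range (16 ^ (j + 1)), S j q t * ((j + 1 : ℕ) : ℝ≥0∞) := by
    intro t ht
    rcases hl : gridLevel m (stopTime (Exceeds m γ) t) with _ | j
    · simp
    · have hj : j < m := by
        have := gridLevel_le m (stopTime (Exceeds m γ) t)
        omega
      refine le_trans ?_ (Finset.single_le_sum (f := fun j => ∑ q ∈ Finset.range (16 ^ (j + 1)),
        S j q t * ((j + 1 : ℕ) : ℝ≥0∞)) (fun _ _ => zero_le) (Finset.mem_range.2 hj))
      rw [← Finset.sum_mul]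
      have := level_indicator_le m j hj t ht (16 * 4 ^ (j + 1)) hl
      calc ((j + 1 : ℕ) : ℝ≥0∞) = 1 * ((j + 1 : ℕ) : ℝ≥0∞) := (one_mul _).symm
        _ ≤ _ := mul_le_mul_left this _
  refine (expect_unifBits_mono hpt).trans ?_
  simp only [PMF.expect_finset_sum, PMF.expect_mul_right]
  have hterm : ∀ j ∈ Finset.range m, (∑ q ∈ Finset.range (16 ^ (j + 1)),
      (unifBits (16 ^ m)).expect (S j q) * ((j + 1 : ℕ) : ℝ≥0∞)) ≤ 2⁻¹ ^ (10 + (j + 1)) := by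
    intro j hj
    rw [Finset.mem_range] at hj
    have hq : ∀ q ∈ Finset.range (16 ^ (j + 1)),
        (unifBits (16 ^ m)).expect (S j q) * ((j + 1 : ℕ) : ℝ≥0∞) ≤
          2⁻¹ ^ (15 + 16 * (j + 1)) * 2 ^ (j + 1) := by
      intro q _
      refine mul_le_mul' ?_ (by exact_mod_cast Nat.lt_two_pow_self.le)
      rw [hS, PMF.expect_mul_right]
      refine (mul_le_mul_left (h.expect_segment_le h0 h1 _ _ _ _) _).trans ?_
      refine exp_barrier_tail_le hj (hm (by omega)) ?_
      gcongr
      exact (Nat.mod_lt q (by norm_num)).le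
    refine (Finset.sum_le_sum hq).trans ?_
    rw [Finset.sum_const, Finset.card_range, nsmul_eq_mul]
    have hc : (2⁻¹ : ℝ≥0∞) * 2 = 1 := ENNReal.inv_mul_cancel (by simp) (by simp)
    have h16 : ((16 ^ (j + 1) : ℕ) : ℝ≥0∞) = 2 ^ (4 * (j + 1)) := by
      rw [pow_mul]; norm_num
    -- The `16 ^ (j + 1)` candidates and the weight `j + 1 ≤ 2 ^ (j + 1)` use up only `2 ^ (5 (j +
    -- 1))` of the tail bound; what is left is summable in `j`.
    calc ((16 ^ (j + 1) : ℕ) : ℝ≥0∞) * (2⁻¹ ^ (15 + 16 * (j + 1)) * 2 ^ (j + 1))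
        = (2⁻¹ * 2) ^ (5 * (j + 1)) * 2⁻¹ ^ (15 + 11 * (j + 1)) := by
          rw [h16, mul_pow]; ring
      _ = 2⁻¹ ^ (15 + 11 * (j + 1)) := by rw [hc, one_pow, one_mul]
      _ ≤ 2⁻¹ ^ (10 + (j + 1)) := pow_le_pow_of_le_one zero_le (by norm_num) (by omega)
  refine (Finset.sum_le_sum hterm).trans ?_
  simp only [pow_add _ 10, ← Finset.mul_sum]
  calc _ ≤ (2⁻¹ : ℝ≥0∞) ^ 10 * ∑' j : ℕ, 2⁻¹ ^ (j + 1) := by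
        gcongr
        exact ENNReal.sum_le_tsum _
    _ = 2⁻¹ ^ 10 := by
        have := PMF.fairGeometric.tsum_coe
        simp only [PMF.fairGeometric_apply] at this
        rw [this, mul_one]

/-- The only time of level 0 before the end is 0, where the empty product 1 is below the barrier
`e`. -/
theorem one_le_gridLevel {m : ℕ} {γ : List Bool → Bool → ℝ≥0∞} {t : List Bool}
    (ht : t.length = 16 ^ m) (h : stopTime (Exceeds m γ) t < 16 ^ m) :
    1 ≤ gridLevel m (stopTime (Exceeds m γ) t) := by
  rw [Nat.one_le_iff_ne_zero]
  intro h0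
  have hd := pow_gridLevel_dvd m (stopTime (Exceeds m γ) t)
  rw [h0, Nat.sub_zero] at hd
  have hz := Nat.eq_zero_of_dvd_of_lt hd h
  have hC := take_stopTime (C := Exceeds m γ) (t := t) (by rw [ht]; exact h)
  rw [hz] at hC
  exact not_exceeds_nil m γ (by simpa using hC)

theorem Sampleable.sendGridAlice {X : Type u} {Y : Type v} (m B : ℕ) (f : X → ℕ)
    (hf : ∀ x, f x ≤ B) :
    Sampleable (fun (x : X) (_ : Y) => PMF.pure (f x)) fun x _ =>
      (1 + 2 * ((gridLevel m (f x)).size : ℝ≥0∞)) +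
        (1 + 2 * ((f x / 16 ^ (m - gridLevel m (f x))).size : ℝ≥0∞)) := by
  refine ((bind (sendNatAlice m (fun x => gridLevel m (f x))
    fun x => (gridLevel_le m _).trans_lt Nat.lt_two_pow_self) fun j =>
      bind (sendNatAlice B (fun x => f x / 16 ^ (m - j))
        fun x => ((Nat.div_le_self _ _).trans (hf x)).trans_lt Nat.lt_two_pow_self) fun q =>
          pure (q * 16 ^ (m - j))).congr fun x y => ?_).mono fun x y => ?_
  · rw [PMF.pure_bind, PMF.pure_bind, Nat.div_mul_cancel (pow_gridLevel_dvd _ _)]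
  · simp

/-- A level `j` has at most `j` binary digits, and an index on its grid is at most `16 ^ j`, hence
has at most `4 j + 1`. -/
theorem grid_cost_le {m i : ℕ} (hi : i ≤ 16 ^ m) :
    (1 + 2 * ((gridLevel m i).size : ℝ≥0∞)) + (1 + 2 * ((i / 16 ^ (m - gridLevel m i)).size : ℝ≥0∞)) ≤
      4 + 10 * (gridLevel m i : ℝ≥0∞) := by
  set j := gridLevel m i
  have h1 : j.size ≤ j := Nat.size_le.2 Nat.lt_two_pow_self
  have h2 : (i / 16 ^ (m - j)).size ≤ 4 * j + 1 := by
    rw [Nat.size_le]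
    have hj : j ≤ m := gridLevel_le m i
    have : i / 16 ^ (m - j) ≤ 16 ^ j := by
      apply Nat.div_le_of_le_mul
      rwa [← pow_add, Nat.sub_add_cancel hj]
    calc _ ≤ 16 ^ j := this
      _ = 2 ^ (4 * j) := by rw [pow_mul]; norm_num
      _ < 2 ^ (4 * j + 1) := by rw [pow_succ]; have := Nat.two_pow_pos (4 * j); omega
  exact_mod_cast (by omega : (1 + 2 * j.size) + (1 + 2 * (i / 16 ^ (m - j)).size) ≤ 4 + 10 * j)

/-! ### The channel protocol as a tilt of uniform bits -/

namespace Protocol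

variable {X : Type u} {Y : Type v}

/-- The history after a received bit (unchanged if the communication is over). -/
def advance (π : Protocol X Y) (h : List Bool) (r : Bool) : List Bool :=
  match π.next h with
  | none => h
  | some _ => h ++ [r]

/-- The history after a string of received bits. -/
def advances (π : Protocol X Y) (s u : List Bool) : List Bool := u.foldl π.advance s

/-- Alice's factor in the density of the next received bit with respect to a uniform bit. -/
noncomputable def factorAlice (π : Protocol X Y) (ε : ℝ) (x : X) (h : List Bool) (r : Bool) :
    ℝ≥0∞ :=
  match π.next h with
  | some .alice => ENNReal.ofReal (if r = π.aliceBit x h then 1 + 2 * ε else 1 - 2 * ε)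
  | _ => 1

/-- Bob's factor in the density of the next received bit with respect to a uniform bit. -/
noncomputable def factorBob (π : Protocol X Y) (ε : ℝ) (y : Y) (h : List Bool) (r : Bool) :
    ℝ≥0∞ :=
  match π.next h with
  | some .bob => ENNReal.ofReal (if r = π.bobBit y h then 1 + 2 * ε else 1 - 2 * ε)
  | _ => 1

/-- The law of the history one round after `h`. -/
noncomputable def stepLaw (C : Bool → PMF Bool) (π : Protocol X Y) (x : X) (y : Y)
    (h : List Bool) : PMF (List Bool) :=
  match π.sentBit x y h with
  | none => PMF.pure h
  | some b => (C b).map fun r => h ++ [r]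

/-- The law of the history `n` rounds after `h`. -/
noncomputable def completion (C : Bool → PMF Bool) (π : Protocol X Y) (x : X) (y : Y) :
    ℕ → List Bool → PMF (List Bool)
  | 0, h => PMF.pure h
  | n + 1, h => (π.stepLaw C x y h).bind (π.completion C x y n)

theorem isTilt_factorAlice (π : Protocol X Y) (ε : ℝ) (x : X) : IsTilt ε (π.factorAlice ε x) := by
  intro h
  unfold factorAlice
  rcases π.next h with _ | _ | _
  · exact .inl fun _ => rfl
  · exact .inr ⟨π.aliceBit x h, by simp⟩
  · exact .inl fun _ => rfl

theorem isTilt_factorBob (π : Protocol X Y) (ε : ℝ) (y : Y) : IsTilt ε (π.factorBob ε y) := by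
  intro h
  unfold factorBob
  rcases π.next h with _ | _ | _
  · exact .inl fun _ => rfl
  · exact .inl fun _ => rfl
  · exact .inr ⟨π.bobBit y h, by simp⟩

theorem expect_bsc {ε : ℝ} (hε : 1 / 2 - ε ∈ Set.Icc (0 : ℝ) (1 / 2)) (b : Bool)
    (F : Bool → ℝ≥0∞) :
    (bsc (1 / 2 - ε) hε b).expect F =
      2⁻¹ * (ENNReal.ofReal (if true = b then 1 + 2 * ε else 1 - 2 * ε) * F true +
        ENNReal.ofReal (if false = b then 1 + 2 * ε else 1 - 2 * ε) * F false) := by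
  have h2 : (2⁻¹ : ℝ≥0∞) = ENNReal.ofReal 2⁻¹ := by
    rw [ENNReal.ofReal_inv_of_pos (by norm_num)]; norm_num
  have key : ∀ r : Bool, bsc (1 / 2 - ε) hε b r =
      2⁻¹ * ENNReal.ofReal (if r = b then 1 + 2 * ε else 1 - 2 * ε) := by
    intro r
    rw [h2, ← ENNReal.ofReal_mul (by norm_num)]
    change ENNReal.ofReal _ = _
    congr 1
    split_ifs <;> ring
  rw [PMF.expect, tsum_bool, key, key, add_comm]
  ring

/-- Only the speaker's factor is nontrivial, so the density is a product of a term Alice can compute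
and a term Bob can compute. Once the communication is over, both factors are 1 and the proposed bit
is ignored. -/
theorem expect_stepLaw {ε : ℝ} (hε : 1 / 2 - ε ∈ Set.Icc (0 : ℝ) (1 / 2)) (π : Protocol X Y)
    (x : X) (y : Y) (h : List Bool) (F : List Bool → ℝ≥0∞) :
    (π.stepLaw (bsc (1 / 2 - ε) hε) x y h).expect F =
      2⁻¹ * (π.factorAlice ε x h true * π.factorBob ε y h true * F (π.advance h true) +
        π.factorAlice ε x h false * π.factorBob ε y h false * F (π.advance h false)) := by
  unfold stepLaw sentBit factorAlice factorBob advance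
  rcases π.next h with _ | _ | _
  · simp [mul_add, ← add_mul, ENNReal.inv_two_add_inv_two]
  · simp only [PMF.expect_map, expect_bsc, mul_one]
  · simp only [PMF.expect_map, expect_bsc, one_mul]

section Bounded

variable {π : Protocol X Y} {T : ℕ}

theorem completion_succ_eq (hT : ∀ h : List Bool, T ≤ h.length → π.next h = none)
    (C : Bool → PMF Bool) (x : X) (y : Y) (n : ℕ) (h : List Bool) (hn : T ≤ h.length + n) :
    π.completion C x y (n + 1) h = π.completion C x y n h := by
  induction n generalizing h with
  | zero => simp [completion, stepLaw, sentBit, hT h (by simpa using hn)]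
  | succ n ih =>
    rw [completion, completion]
    unfold stepLaw
    cases hs : π.sentBit x y h with
    | none =>
      simp only [PMF.pure_bind]
      rw [completion, stepLaw, hs]
      simp
    | some b =>
      simp only [PMF.bind_map]
      congr 1
      ext1 r
      exact ih _ (by simp; omega)

/-- From any history, `T` rounds already reach the end, so an extra round changes nothing. This
makes the probability of each final transcript harmonic, as optional stopping requires. -/
theorem stepLaw_bind_completion (hT : ∀ h : List Bool, T ≤ h.length → π.next h = none)
    (C : Bool → PMF Bool) (x : X) (y : Y) (h : List Bool) :
    (π.stepLaw C x y h).bind (π.completion C x y T) = π.completion C x y T h :=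
  completion_succ_eq hT C x y T h (by omega)

theorem completion_of_next_none (C : Bool → PMF Bool) (x : X) (y : Y) (n : ℕ) {h : List Bool}
    (hh : π.next h = none) : π.completion C x y n h = PMF.pure h := by
  induction n with
  | zero => rfl
  | succ n ih => rw [completion, stepLaw, sentBit, hh, PMF.pure_bind, ih]

end Bounded

theorem advances_of_next_none {π : Protocol X Y} {s : List Bool} (hs : π.next s = none)
    (u : List Bool) : π.advances s u = s := by
  induction u with
  | nil => rfl
  | cons b u ih =>
    change π.advances (π.advance s b) u = s
    rwa [advance, hs]

theorem length_advances (π : Protocol X Y) (s u : List Bool)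
    (h : π.next (π.advances s u) ≠ none) : (π.advances s u).length = s.length + u.length := by
  induction u generalizing s with
  | nil => rfl
  | cons b u ih =>
    change (π.advances (π.advance s b) u).length = _
    change π.next (π.advances (π.advance s b) u) ≠ none at h
    have hs : π.next s ≠ none := fun hs => by
      rw [advance, hs, advances_of_next_none hs] at h
      exact h hs
    obtain ⟨q, hq⟩ := Option.ne_none_iff_exists'.1 hs
    rw [ih _ h, advance, hq]
    simp
    omega

/-- The likelihood ratio of Alice's part along the received bits `u`, starting at history `s`. -/
noncomputable def weightAlice (π : Protocol X Y) (ε : ℝ) (x : X) (s u : List Bool) : ℝ≥0∞ :=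
  prodWeight (fun u => π.factorAlice ε x (π.advances s u)) u

/-- The likelihood ratio of Bob's part along the received bits `u`, starting at history `s`. -/
noncomputable def weightBob (π : Protocol X Y) (ε : ℝ) (y : Y) (s u : List Bool) : ℝ≥0∞ :=
  prodWeight (fun u => π.factorBob ε y (π.advances s u)) u

/-- For `F` harmonic, weight times `F` is a martingale along uniform bits: the factors turn the
uniform average into the average under the channel. -/
theorem expect_weight_take_stopTime {ε : ℝ} (hε : 1 / 2 - ε ∈ Set.Icc (0 : ℝ) (1 / 2))
    (π : Protocol X Y) (x : X) (y : Y) (s : List Bool) (n : ℕ) (D : List Bool → Prop)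
    (F : List Bool → ℝ≥0∞)
    (hF : ∀ h, (π.stepLaw (bsc (1 / 2 - ε) hε) x y h).expect F = F h) :
    ((unifBits n).expect fun t =>
      π.weightAlice ε x s (t.take (stopTime D t)) * π.weightBob ε y s (t.take (stopTime D t)) *
        F (π.advances s (t.take (stopTime D t)))) = F s := by
  rw [expect_take_stopTime n D fun u =>
    π.weightAlice ε x s u * π.weightBob ε y s u * F (π.advances s u)]
  · simp [weightAlice, weightBob, prodWeight, advances]
  · intro u
    simp only [weightAlice, weightBob, prodWeight_concat]
    rw [← hF (π.advances s u), expect_stepLaw]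
    have hadv : ∀ b, π.advances s (u ++ [b]) = π.advance (π.advances s u) b := fun b => by
      simp [advances]
    rw [hadv, hadv]
    ring

/-- Sampling the rest of the transcript bit by bit. -/
theorem sampleable_completion (C : Bool → PMF Bool) (π : Protocol X Y) (n : ℕ) (s : List Bool) :
    Sampleable (fun x y => π.completion C x y n s)
      fun _ _ => if π.next s = none then 0 else (n : ℝ≥0∞) := by
  induction n generalizing s with
  | zero => exact (Sampleable.pure s).mono fun _ _ => zero_le
  | succ n ih =>
    cases hs : π.next s with
    | none =>
      refine ((Sampleable.pure s).congr fun x y => ?_).mono fun _ _ => by simp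
      rw [completion_of_next_none C x y _ hs]
    | some q =>
      have hcost : ∀ (p : PMF Bool), (1 : ℝ≥0∞) + (p.expect fun r =>
          if π.next (s ++ [r]) = none then 0 else (n : ℝ≥0∞)) ≤ ((n + 1 : ℕ) : ℝ≥0∞) := by
        intro p
        rw [Nat.cast_succ, add_comm]
        gcongr
        refine (p.expect_mono (ψ := fun _ => (n : ℝ≥0∞)) fun r => ?_).trans (by simp)
        split_ifs <;> simp
      cases q with
      | alice =>
        refine ((Sampleable.bind (Sampleable.coinAlice fun x => C (π.aliceBit x s))
          fun r => ih (s ++ [r])).congr fun x y => ?_).mono fun x y => ?_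
        · rw [completion, stepLaw, sentBit, hs]
          simp [PMF.bind_map, Function.comp_def]
        · simpa using hcost _
      | bob =>
        refine ((Sampleable.bind (Sampleable.coinBob fun y => C (π.bobBit y s))
          fun r => ih (s ++ [r])).congr fun x y => ?_).mono fun x y => ?_
        · rw [completion, stepLaw, sentBit, hs]
          simp [PMF.bind_map, Function.comp_def]
        · simpa using hcost _

end Protocol

/-! ### One trial of rejection sampling -/

namespace Protocol

variable {X : Type u} {Y : Type v}

/-- The first time along the proposed bits at which one of the parties wants to stop. -/
noncomputable def blockTime (π : Protocol X Y) (ε : ℝ) (m : ℕ) (x : X) (y : Y)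
    (s t : List Bool) : ℕ :=
  stopTime (fun u => Exceeds m (fun u => π.factorAlice ε x (π.advances s u)) u ∨
    Exceeds m (fun u => π.factorBob ε y (π.advances s u)) u) t

/-- One trial of rejection sampling: uniform bits are proposed up to the stopping time of the block
and accepted with probability proportional to the likelihood ratios. If the proposal is rejected,
the history does not change. -/
noncomputable def trialLaw (π : Protocol X Y) (ε : ℝ) (m : ℕ) (s : List Bool) (x : X) (y : Y) :
    PMF (List Bool) :=
  (unifBits (16 ^ m)).bind fun t =>
    (PMF.coin (π.weightAlice ε x s (t.take (π.blockTime ε m x y s t)) / 16)).bind fun α =>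
      (PMF.coin (π.weightBob ε y s (t.take (π.blockTime ε m x y s t)) / 16)).bind fun β =>
        PMF.pure (if α && β then π.advances s (t.take (π.blockTime ε m x y s t)) else s)

section Trial

variable {ε : ℝ} (π : Protocol X Y) (m : ℕ) (s : List Bool) (x : X) (y : Y)

/-- Each of the two times depends on one party's input only, so announcing both reveals the cut to
everyone. -/
theorem blockTime_eq_min (t : List Bool) : π.blockTime ε m x y s t =
    min (stopTime (Exceeds m fun u => π.factorAlice ε x (π.advances s u)) t)
      (stopTime (Exceeds m fun u => π.factorBob ε y (π.advances s u)) t) :=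
  stopTime_or _ _ t

theorem weightAlice_blockTime_le (h0 : 0 ≤ ε) (h1 : ε ≤ 1 / 2) (t : List Bool) :
    π.weightAlice ε x s (t.take (π.blockTime ε m x y s t)) ≤ 16 :=
  ((π.isTilt_factorAlice ε x).comp (π.advances s)).prodWeight_take_le h0 h1 m t
    (π.blockTime_eq_min m s x y t ▸ min_le_left _ _)

theorem weightBob_blockTime_le (h0 : 0 ≤ ε) (h1 : ε ≤ 1 / 2) (t : List Bool) :
    π.weightBob ε y s (t.take (π.blockTime ε m x y s t)) ≤ 16 :=
  ((π.isTilt_factorBob ε y).comp (π.advances s)).prodWeight_take_le h0 h1 m t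
    (π.blockTime_eq_min m s x y t ▸ min_le_right _ _)

/-- The probability that proposed bits are accepted. -/
noncomputable def acceptProb (π : Protocol X Y) (ε : ℝ) (m : ℕ) (s : List Bool) (x : X) (y : Y)
    (t : List Bool) : ℝ≥0∞ :=
  π.weightAlice ε x s (t.take (π.blockTime ε m x y s t)) / 16 *
    (π.weightBob ε y s (t.take (π.blockTime ε m x y s t)) / 16)

theorem acceptProb_eq (t : List Bool) : π.acceptProb ε m s x y t =
    π.weightAlice ε x s (t.take (π.blockTime ε m x y s t)) *
      π.weightBob ε y s (t.take (π.blockTime ε m x y s t)) * 256⁻¹ := by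
  have : (256 : ℝ≥0∞)⁻¹ = 16⁻¹ * 16⁻¹ := by
    rw [← ENNReal.mul_inv (by simp) (by simp)]; norm_num
  rw [acceptProb, this, ENNReal.div_eq_inv_mul, ENNReal.div_eq_inv_mul]
  ring

theorem expect_acceptProb (hε : 1 / 2 - ε ∈ Set.Icc (0 : ℝ) (1 / 2))
    (F : List Bool → ℝ≥0∞)
    (hF : ∀ h, (π.stepLaw (bsc (1 / 2 - ε) hε) x y h).expect F = F h) :
    ((unifBits (16 ^ m)).expect fun t => π.acceptProb ε m s x y t *
      F (π.advances s (t.take (π.blockTime ε m x y s t)))) = F s * 256⁻¹ := by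
  rw [← expect_weight_take_stopTime hε π x y s (16 ^ m) (fun u =>
    Exceeds m (fun u => π.factorAlice ε x (π.advances s u)) u ∨
    Exceeds m (fun u => π.factorBob ε y (π.advances s u)) u) F hF, ← PMF.expect_mul_right]
  congr 1
  ext t
  rw [acceptProb_eq, blockTime]
  ring

theorem expect_acceptProb_one (hε : 1 / 2 - ε ∈ Set.Icc (0 : ℝ) (1 / 2)) :
    (unifBits (16 ^ m)).expect (π.acceptProb ε m s x y) = 256⁻¹ := by
  simpa using π.expect_acceptProb m s x y hε (fun _ => 1) (by simp)

/-- A rejection, of probability `1 - 256⁻¹`, leaves `s`. The term `256⁻¹ * F s` is added on the left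
to avoid truncated subtraction. -/
theorem expect_trialLaw (h0 : 0 ≤ ε) (h1 : ε ≤ 1 / 2)
    (hε : 1 / 2 - ε ∈ Set.Icc (0 : ℝ) (1 / 2)) (F : List Bool → ℝ≥0∞) :
    (π.trialLaw ε m s x y).expect F + 256⁻¹ * F s =
      ((unifBits (16 ^ m)).expect fun t => π.acceptProb ε m s x y t *
        F (π.advances s (t.take (π.blockTime ε m x y s t)))) + F s := by
  rw [← π.expect_acceptProb_one m s x y hε, ← PMF.expect_mul_right, trialLaw, PMF.expect_bind,
    ← PMF.expect_add, ← (unifBits (16 ^ m)).expect_const (F s), ← PMF.expect_add, PMF.expect_const]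
  congr 1
  ext t
  have hA : π.weightAlice ε x s (t.take (π.blockTime ε m x y s t)) / 16 ≤ 1 :=
    ENNReal.div_le_of_le_mul (by simpa using π.weightAlice_blockTime_le m s x y h0 h1 t)
  have hB : π.weightBob ε y s (t.take (π.blockTime ε m x y s t)) / 16 ≤ 1 :=
    ENNReal.div_le_of_le_mul (by simpa using π.weightBob_blockTime_le m s x y h0 h1 t)
  simp only [PMF.expect_bind, PMF.expect_pure, PMF.expect_coin hA, PMF.expect_coin hB, acceptProb]
  generalize π.weightAlice ε x s (t.take (π.blockTime ε m x y s t)) / 16 = a at *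
  generalize π.weightBob ε y s (t.take (π.blockTime ε m x y s t)) / 16 = b at *
  have ha := add_tsub_cancel_of_le hA
  have hb := add_tsub_cancel_of_le hB
  simp only [Bool.and_self, Bool.and_false, Bool.and_true, if_true,
    Bool.false_eq_true, if_false]
  generalize F s = f
  generalize F (π.advances s (t.take (π.blockTime ε m x y s t))) = g
  calc a * (b * g + (1 - b) * f) + (1 - a) * (b * f + (1 - b) * f) + a * b * f
      = a * b * g + (a * (b + (1 - b)) + (1 - a) * (b + (1 - b))) * f := by ring
    _ = a * b * g + f := by rw [hb, mul_one, mul_one, ha, one_mul]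

/-- For harmonic `F` the accepted part contributes exactly `256⁻¹ * F s`, which cancels: neither
acceptance nor rejection biases the final transcript. -/
theorem trialLaw_bind_completion {T : ℕ} (hT : ∀ h : List Bool, T ≤ h.length → π.next h = none)
    (h0 : 0 ≤ ε) (h1 : ε ≤ 1 / 2) (hε : 1 / 2 - ε ∈ Set.Icc (0 : ℝ) (1 / 2)) :
    (π.trialLaw ε m s x y).bind (π.completion (bsc (1 / 2 - ε) hε) x y T) =
      π.completion (bsc (1 / 2 - ε) hε) x y T s := by
  ext z
  rw [PMF.bind_apply_eq_expect]
  have key := π.expect_trialLaw m s x y h0 h1 hε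
    fun h => π.completion (bsc (1 / 2 - ε) hε) x y T h z
  rw [π.expect_acceptProb m s x y hε fun h => π.completion (bsc (1 / 2 - ε) hε) x y T h z,
    add_comm, mul_comm] at key
  · refine (ENNReal.add_right_inj ?_).1 key
    exact ENNReal.mul_ne_top (PMF.apply_ne_top _ _) (by simp)
  · intro h
    rw [← PMF.bind_apply_eq_expect, stepLaw_bind_completion hT]

/-- A trial costs a bounded number of bits. -/
theorem sampleable_trialLaw (h0 : 0 ≤ ε) (h1 : ε ≤ 1 / 2)
    (hm : m ≠ 0 → 8192 * ε ^ 2 * 16 ^ m ≤ 1) :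
    Sampleable (π.trialLaw ε m s) fun _ _ => 11 := by
  refine ((Sampleable.bind (Sampleable.publicCoin (unifBits (16 ^ m))) fun t =>
    Sampleable.bind (Sampleable.sendGridAlice m t.length (fun x =>
      stopTime (Exceeds m fun u => π.factorAlice ε x (π.advances s u)) t)
      fun x => stopTime_le_length _ t) fun a =>
    Sampleable.bind (Sampleable.sendGridAlice m t.length (fun y =>
      stopTime (Exceeds m fun u => π.factorBob ε y (π.advances s u)) t)
      fun x => stopTime_le_length _ t).swap fun b =>
    Sampleable.bind (Sampleable.coinAlice fun x =>
      PMF.coin (π.weightAlice ε x s (t.take (min a b)) / 16)) fun α =>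
    Sampleable.bind (Sampleable.coinBob fun y =>
      PMF.coin (π.weightBob ε y s (t.take (min a b)) / 16)) fun β =>
    Sampleable.pure (if α && β then π.advances s (t.take (min a b)) else s)).congr
      fun x y => ?_).mono fun x y => ?_
  · simp only [PMF.pure_bind, ← blockTime_eq_min]
    rfl
  · simp only [PMF.expect_const, zero_add, add_zero]
    have hA := ((π.isTilt_factorAlice ε x).comp (π.advances s)).expect_gridLevel_le h0 h1 hm
    have hB := ((π.isTilt_factorBob ε y).comp (π.advances s)).expect_gridLevel_le h0 h1 hm
    set σ := stopTime (Exceeds m fun u => π.factorAlice ε x (π.advances s u)) with hσ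
    set τ := stopTime (Exceeds m fun u => π.factorBob ε y (π.advances s u)) with hτ
    -- Each announcement costs `4 + 10 · level` and the two acceptance coins cost one bit each; with
    -- mean levels at most `2⁻¹⁰`, the excess over 10 is below 1.
    calc _ ≤ (unifBits (16 ^ m)).expect fun t =>
          ((gridLevel m (σ t) : ℝ≥0∞) * 10 + (gridLevel m (τ t) : ℝ≥0∞) * 10) + 10 := by
          refine expect_unifBits_mono fun t ht => ?_
          refine (add_le_add (grid_cost_le (ht ▸ stopTime_le_length _ t)) (add_le_add
            (grid_cost_le (ht ▸ stopTime_le_length _ t)) le_rfl)).trans (le_of_eq ?_)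
          ring
      _ ≤ (2⁻¹ ^ 10 * 10 + 2⁻¹ ^ 10 * 10) + 10 := by
          rw [PMF.expect_add, PMF.expect_add, PMF.expect_mul_right, PMF.expect_mul_right,
            PMF.expect_const]
          gcongr
      _ ≤ (2⁻¹ ^ 10 * 2 ^ 4 + 2⁻¹ ^ 10 * 2 ^ 4) + 10 := by gcongr <;> norm_num
      _ = (2⁻¹ * 2) ^ 4 * 2⁻¹ ^ 5 * (2⁻¹ + 2⁻¹) + 10 := by rw [mul_pow]; ring
      _ ≤ 1 + 10 := by
          rw [ENNReal.inv_mul_cancel (by simp) (by simp), ENNReal.inv_two_add_inv_two]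
          gcongr
          simpa using pow_le_one₀ (n := 5) zero_le (by norm_num : (2⁻¹ : ℝ≥0∞) ≤ 1)
      _ = 11 := by norm_num

/-! ### Expected progress of a trial -/

/-- An upper bound for the number of blocks that remain to be simulated. -/
noncomputable def blocksLeft (π : Protocol X Y) (T k : ℕ) (h : List Bool) : ℕ :=
  if π.next h = none then 0 else (T - h.length) / k + 1

variable {π} in
theorem blocksLeft_advances_le {T : ℕ} (k : ℕ) (hs : π.next s ≠ none) (u : List Bool) :
    π.blocksLeft T k (π.advances s u) ≤ π.blocksLeft T k s := by
  rw [blocksLeft, blocksLeft, if_neg hs]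
  split_ifs with h
  · exact Nat.zero_le _
  · rw [π.length_advances s u h]
    exact Nat.succ_le_succ (Nat.div_le_div_right (by omega))

variable {π} in
theorem blocksLeft_advances_succ_le {T : ℕ} (hT : ∀ h : List Bool, T ≤ h.length → π.next h = none)
    {k : ℕ} (hk : 0 < k) (hs : π.next s ≠ none) {u : List Bool} (hu : u.length = k) :
    π.blocksLeft T k (π.advances s u) + 1 ≤ π.blocksLeft T k s := by
  rw [blocksLeft, blocksLeft, if_neg hs]
  split_ifs with h
  · exact Nat.succ_le_succ (Nat.zero_le _)
  · have hlt : (π.advances s u).length < T := lt_of_not_ge fun h' => h (hT _ h')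
    rw [π.length_advances s u h, hu] at *
    have : T - s.length = (T - (s.length + k)) + k := by omega
    rw [this, Nat.add_div_right _ hk]

open Classical in
/-- A block that is accepted has full length with probability at least one half. -/
theorem expect_acceptProb_full_block (h0 : 0 ≤ ε) (h1 : ε ≤ 1 / 2)
    (hε : 1 / 2 - ε ∈ Set.Icc (0 : ℝ) (1 / 2)) (hm : m ≠ 0 → 8192 * ε ^ 2 * 16 ^ m ≤ 1) :
    512⁻¹ ≤ (unifBits (16 ^ m)).expect fun t => π.acceptProb ε m s x y t *
      if π.blockTime ε m x y s t = 16 ^ m then 1 else 0 := by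
  have hA := ((π.isTilt_factorAlice ε x).comp (π.advances s)).expect_gridLevel_le h0 h1 hm
  have hB := ((π.isTilt_factorBob ε y).comp (π.advances s)).expect_gridLevel_le h0 h1 hm
  set σ := stopTime (Exceeds m fun u => π.factorAlice ε x (π.advances s u)) with hσ
  set τ := stopTime (Exceeds m fun u => π.factorBob ε y (π.advances s u)) with hτ
  set P := (unifBits (16 ^ m)).expect fun t => π.acceptProb ε m s x y t *
      if π.blockTime ε m x y s t = 16 ^ m then 1 else 0 with hP
  have hacc : ∀ t, π.acceptProb ε m s x y t ≤ 1 := fun t => mul_le_one'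
    (ENNReal.div_le_of_le_mul (by simpa using π.weightAlice_blockTime_le m s x y h0 h1 t))
    (ENNReal.div_le_of_le_mul (by simpa using π.weightBob_blockTime_le m s x y h0 h1 t))
  -- A short block forces one party's level to be at least 1, so its probability is bounded by the
  -- mean levels. This leaves `2⁻⁸ - 2 · 2⁻¹⁰ = 2⁻⁹`.
  have hsum : (256 : ℝ≥0∞)⁻¹ ≤ P + (2⁻¹ ^ 10 + 2⁻¹ ^ 10) := by
    rw [← π.expect_acceptProb_one m s x y hε]
    calc _ ≤ (unifBits (16 ^ m)).expect fun t => (π.acceptProb ε m s x y t *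
          if π.blockTime ε m x y s t = 16 ^ m then 1 else 0) +
            ((gridLevel m (σ t) : ℝ≥0∞) + (gridLevel m (τ t) : ℝ≥0∞)) := by
          refine expect_unifBits_mono fun t ht => ?_
          split_ifs with h
          · simp
          · rw [mul_zero, zero_add]
            refine (hacc t).trans ?_
            rw [blockTime_eq_min, ← hσ, ← hτ] at h
            have hσle : σ t ≤ 16 ^ m := ht ▸ stopTime_le_length _ t
            have hτle : τ t ≤ 16 ^ m := ht ▸ stopTime_le_length _ t
            have : 1 ≤ gridLevel m (σ t) + gridLevel m (τ t) := by
              rcases lt_or_ge (σ t) (16 ^ m) with h' | h'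
              · have := one_le_gridLevel ht h'
                rw [← hσ] at this
                omega
              · have := one_le_gridLevel (γ := fun u => π.factorBob ε y (π.advances s u)) ht
                  (by rw [← hτ]; omega)
                rw [← hτ] at this
                omega
            exact_mod_cast this
      _ ≤ _ := by
          rw [PMF.expect_add, PMF.expect_add]
          gcongr
  have h256 : (256 : ℝ≥0∞)⁻¹ = 2⁻¹ ^ 8 := by rw [← ENNReal.inv_pow]; norm_num
  have h512 : (512 : ℝ≥0∞)⁻¹ = 2⁻¹ ^ 9 := by rw [← ENNReal.inv_pow]; norm_num
  have h10 : (2⁻¹ : ℝ≥0∞) ^ 10 + 2⁻¹ ^ 10 = 2⁻¹ ^ 9 := by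
    rw [pow_succ _ 9, ← mul_add, ENNReal.inv_two_add_inv_two, mul_one]
  have h9 : (2⁻¹ : ℝ≥0∞) ^ 9 + 2⁻¹ ^ 9 = 2⁻¹ ^ 8 := by
    rw [pow_succ _ 8, ← mul_add, ENNReal.inv_two_add_inv_two, mul_one]
  rw [h256, h10, ← h9] at hsum
  rw [h512]
  exact (ENNReal.add_le_add_iff_right (by simp)).1 hsum

variable {s} in
/-- A trial makes progress in expectation. -/
theorem expect_blocksLeft_trialLaw {T : ℕ}
    (hT : ∀ h : List Bool, T ≤ h.length → π.next h = none) (hs : π.next s ≠ none)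
    (h0 : 0 ≤ ε) (h1 : ε ≤ 1 / 2) (hε : 1 / 2 - ε ∈ Set.Icc (0 : ℝ) (1 / 2))
    (hm : m ≠ 0 → 8192 * ε ^ 2 * 16 ^ m ≤ 1) :
    ((π.trialLaw ε m s x y).expect fun h => (π.blocksLeft T (16 ^ m) h : ℝ≥0∞)) + 512⁻¹ ≤
      π.blocksLeft T (16 ^ m) s := by
  classical
  have key := π.expect_trialLaw m s x y h0 h1 hε fun h => (π.blocksLeft T (16 ^ m) h : ℝ≥0∞)
  have hfull := π.expect_acceptProb_full_block m s x y h0 h1 hε hm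
  set E := (π.trialLaw ε m s x y).expect fun h => (π.blocksLeft T (16 ^ m) h : ℝ≥0∞)
  set f : ℝ≥0∞ := ((π.blocksLeft T (16 ^ m) s : ℕ) : ℝ≥0∞) with hf
  -- An accepted proposal never increases the count, and a full block lowers it by at least one.
  have hbound : ((unifBits (16 ^ m)).expect fun t => π.acceptProb ε m s x y t *
      (π.blocksLeft T (16 ^ m) (π.advances s (t.take (π.blockTime ε m x y s t))) : ℝ≥0∞)) +
      (unifBits (16 ^ m)).expect (fun t => π.acceptProb ε m s x y t *
        if π.blockTime ε m x y s t = 16 ^ m then 1 else 0) ≤ 256⁻¹ * f := by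
    rw [← π.expect_acceptProb_one m s x y hε, ← PMF.expect_mul_right, ← PMF.expect_add]
    refine expect_unifBits_mono fun t ht => ?_
    rw [← mul_add, hf]
    gcongr
    split_ifs with h
    · have := blocksLeft_advances_succ_le s hT (k := 16 ^ m) (by positivity) hs
        (u := t.take (π.blockTime ε m x y s t)) (by simp [h, ht])
      exact_mod_cast this
    · rw [add_zero]
      exact_mod_cast blocksLeft_advances_le s (16 ^ m) hs _
  have hfin : 256⁻¹ * f ≠ ∞ := ENNReal.mul_ne_top (by simp) (by simp [hf])
  refine (ENNReal.add_le_add_iff_right hfin).1 ?_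
  calc E + 512⁻¹ + 256⁻¹ * f = (E + 256⁻¹ * f) + 512⁻¹ := by ring
    _ ≤ _ := by
      rw [key, add_right_comm, add_comm f]
      gcongr
      exact (add_le_add le_rfl hfull).trans hbound

end Trial

end Protocol

/-! ### Iterating trials -/

namespace Protocol

variable {X : Type u} {Y : Type v}

/-- Repeated trials followed by direct sampling of what is left. -/
theorem sampleable_completion_of_trials {ε : ℝ} (π : Protocol X Y) {T : ℕ}
    (hT : ∀ h : List Bool, T ≤ h.length → π.next h = none) (h0 : 0 ≤ ε) (h1 : ε ≤ 1 / 2)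
    (hε : 1 / 2 - ε ∈ Set.Icc (0 : ℝ) (1 / 2)) {m : ℕ}
    (hm : m ≠ 0 → 8192 * ε ^ 2 * 16 ^ m ≤ 1) (N : ℕ) (s : List Bool) :
    Sampleable (fun x y => π.completion (bsc (1 / 2 - ε) hε) x y T s) fun _ _ =>
      (5632 + T * (1 - (512 * ((T / 16 ^ m + 1 : ℕ) : ℝ≥0∞))⁻¹) ^ N) * π.blocksLeft T (16 ^ m) s := by
  -- Decision trees have finite depth, so trials stop after `N` rounds and direct sampling takes
  -- over. At most `T / 16 ^ m + 1` blocks remain, so a drop of `1 / 512` shrinks the expected count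
  -- by the factor `1 - a`, and the fallback cost decays geometrically.
  set a : ℝ≥0∞ := (512 * ((T / 16 ^ m + 1 : ℕ) : ℝ≥0∞))⁻¹ with ha
  have hdone : ∀ s, π.next s = none →
      Sampleable (fun x y => π.completion (bsc (1 / 2 - ε) hε) x y T s) fun _ _ => 0 := by
    intro s hs
    simpa [hs] using π.sampleable_completion (bsc (1 / 2 - ε) hε) T s
  induction N generalizing s with
  | zero =>
    by_cases hs : π.next s = none
    · exact (hdone s hs).mono fun _ _ => zero_le
    · refine (π.sampleable_completion (bsc (1 / 2 - ε) hε) T s).mono fun _ _ => ?_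
      rw [if_neg hs, pow_zero, mul_one, blocksLeft, if_neg hs]
      calc (T : ℝ≥0∞) = T * 1 := (mul_one _).symm
        _ ≤ (5632 + T) * (((T - s.length) / 16 ^ m + 1 : ℕ) : ℝ≥0∞) := by
          gcongr
          · exact le_add_self
          · simp
  | succ N ih =>
    by_cases hs : π.next s = none
    · exact (hdone s hs).mono fun _ _ => zero_le
    · refine ((Sampleable.bind (π.sampleable_trialLaw m s h0 h1 hm) ih).congr fun x y =>
        π.trialLaw_bind_completion m s x y hT h0 h1 hε).mono fun x y => ?_
      have hprog := π.expect_blocksLeft_trialLaw m x y hT hs h0 h1 hε hm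
      simp only [mul_comm (5632 + _ : ℝ≥0∞)]
      rw [PMF.expect_mul_right]
      set E := (π.trialLaw ε m s x y).expect fun h => (π.blocksLeft T (16 ^ m) h : ℝ≥0∞)
      set f : ℝ≥0∞ := ((π.blocksLeft T (16 ^ m) s : ℕ) : ℝ≥0∞) with hf
      have hfa : f * a ≤ 512⁻¹ := by
        have hfle : f ≤ ((T / 16 ^ m + 1 : ℕ) : ℝ≥0∞) := by
          rw [hf, blocksLeft, if_neg hs]
          gcongr
          omega
        rw [ha, ENNReal.mul_inv (by simp) (by simp), mul_left_comm]
        calc _ ≤ 512⁻¹ * (((T / 16 ^ m + 1 : ℕ) : ℝ≥0∞) * ((T / 16 ^ m + 1 : ℕ) : ℝ≥0∞)⁻¹) := by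
              gcongr
          _ = 512⁻¹ := by
              rw [ENNReal.mul_inv_cancel (by simp) (by simp), mul_one]
      have hE : E ≤ f * (1 - a) := by
        rw [ENNReal.mul_sub (fun _ _ => by simp [hf]), mul_one]
        refine ENNReal.le_sub_of_add_le_right (ne_top_of_le_ne_top (by simp) hfa) ?_
        exact (add_le_add le_rfl hfa).trans hprog
      -- The 11 bits of a trial are paid for by the drop `512⁻¹` of the count, at `5632 = 11 · 512`
      -- per block.
      calc 11 + E * (5632 + T * (1 - a) ^ N)
          = 5632 * (E + 512⁻¹) + E * (T * (1 - a) ^ N) := by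
            have : (5632 : ℝ≥0∞) * 512⁻¹ = 11 := by
              rw [show (5632 : ℝ≥0∞) = 11 * 512 by norm_num, mul_assoc,
                ENNReal.mul_inv_cancel (by simp) (by simp), mul_one]
            rw [mul_add 5632, this]; ring
        _ ≤ 5632 * f + (f * (1 - a)) * (T * (1 - a) ^ N) := by gcongr
        _ = f * (5632 + T * (1 - a) ^ (N + 1)) := by ring

theorem sampleable_completion_of_blocks {ε : ℝ} (π : Protocol X Y) {T : ℕ}
    (hT : ∀ h : List Bool, T ≤ h.length → π.next h = none) (h0 : 0 ≤ ε) (h1 : ε ≤ 1 / 2)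
    (hε : 1 / 2 - ε ∈ Set.Icc (0 : ℝ) (1 / 2)) {m : ℕ}
    (hm : m ≠ 0 → 8192 * ε ^ 2 * 16 ^ m ≤ 1) :
    Sampleable (fun x y => π.completion (bsc (1 / 2 - ε) hε) x y T []) fun _ _ =>
      5633 * ((T / 16 ^ m + 1 : ℕ) : ℝ≥0∞) := by
  obtain ⟨N, hN⟩ : ∃ N : ℕ,
      (T : ℝ≥0∞) * (1 - (512 * ((T / 16 ^ m + 1 : ℕ) : ℝ≥0∞))⁻¹) ^ N ≤ 1 := by
    have hlt : 1 - (512 * ((T / 16 ^ m + 1 : ℕ) : ℝ≥0∞))⁻¹ < 1 :=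
      ENNReal.sub_lt_self (by simp) (by simp)
        (ENNReal.inv_ne_zero.2 (ENNReal.mul_ne_top (by simp) (ENNReal.natCast_ne_top _)))
    have hlim := ENNReal.Tendsto.const_mul (a := (T : ℝ≥0∞))
      (ENNReal.tendsto_pow_atTop_nhds_zero_of_lt_one hlt) (.inr (by simp))
    rw [mul_zero] at hlim
    exact ((hlim.eventually_lt_const (zero_lt_one)).exists).imp fun _ h => h.le
  refine (π.sampleable_completion_of_trials hT h0 h1 hε hm N []).mono fun x y => ?_
  calc _ ≤ (5632 + 1) * ((T / 16 ^ m + 1 : ℕ) : ℝ≥0∞) := by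
        gcongr
        rw [blocksLeft]
        split_ifs <;> simp
    _ = _ := by norm_num

/-! ### Reduction of the transcript law to a finite horizon -/

theorem completion_eq_historyLaw (C : Bool → PMF Bool) (π : Protocol X Y) (x : X) (y : Y) (n : ℕ) :
    π.completion C x y n [] = π.historyLaw C x y n := by
  have key : ∀ n h, (π.stepLaw C x y h).bind (π.completion C x y n) =
      (π.completion C x y n h).bind (π.stepLaw C x y) := by
    intro n
    induction n with
    | zero => intro h; simp [completion]
    | succ n ih =>
      intro h
      rw [completion, PMF.bind_bind]
      congr 1
      funext h'
      rw [completion, ih]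
  induction n with
  | zero => rfl
  | succ n ih =>
    rw [completion, key, ih]
    rfl

/-- The protocol that stops after `T` rounds at the latest. -/
def truncate (π : Protocol X Y) (T : ℕ) : Protocol X Y where
  next h := if T ≤ h.length then none else π.next h
  aliceBit := π.aliceBit
  bobBit := π.bobBit

theorem length_le_of_mem_support {C : Bool → PMF Bool} {π : Protocol X Y} {T : ℕ}
    (hT : π.channelCC C = T) {x : X} {y : Y} {n : ℕ} {h : List Bool}
    (hh : h ∈ (π.historyLaw C x y n).support) : h.length ≤ T := by
  have : (h.length : ℕ∞) ≤ π.channelCC C :=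
    le_iSup_of_le x <| le_iSup_of_le y <| le_iSup_of_le n <| le_iSup₂_of_le h hh le_rfl
  rw [hT] at this
  exact_mod_cast this

theorem historyLaw_succ (C : Bool → PMF Bool) (π : Protocol X Y) (x : X) (y : Y) (n : ℕ) :
    π.historyLaw C x y (n + 1) = (π.historyLaw C x y n).bind (π.stepLaw C x y) := rfl

theorem length_eq_of_mem_support {C : Bool → PMF Bool} {π : Protocol X Y} {x : X} {y : Y} {n : ℕ}
    {h : List Bool} (hh : h ∈ (π.historyLaw C x y n).support) (hn : π.next h ≠ none) :
    h.length = n := by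
  induction n generalizing h with
  | zero =>
    have : h = [] := by simpa [historyLaw] using hh
    simp [this]
  | succ n ih =>
    rw [historyLaw_succ, PMF.mem_support_bind_iff] at hh
    obtain ⟨h', hh', hstep⟩ := hh
    rw [stepLaw] at hstep
    cases hs : π.sentBit x y h' with
    | none =>
      rw [hs] at hstep
      obtain rfl : h = h' := by simpa using hstep
      unfold sentBit at hs
      rcases hq : π.next h with _ | _ | _ <;> simp_all
    | some b =>
      rw [hs] at hstep
      obtain ⟨r, -, rfl⟩ := (PMF.mem_support_map_iff _ _ _).1 hstep
      have hn' : π.next h' ≠ none := fun hq => by simp [sentBit, hq] at hs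
      simp [ih hh' hn']

/-- Otherwise one more received bit of positive probability would give a reachable history longer
than `T`. -/
theorem next_eq_none_of_mem_support {C : Bool → PMF Bool} {π : Protocol X Y} {T : ℕ}
    (hT : π.channelCC C = T) {x : X} {y : Y} {n : ℕ} {h : List Bool}
    (hh : h ∈ (π.historyLaw C x y n).support) (hn : T ≤ h.length) : π.next h = none := by
  by_contra hne
  have hlen := length_eq_of_mem_support hh hne
  obtain ⟨q, hq⟩ := Option.ne_none_iff_exists'.1 hne
  obtain ⟨b, hb⟩ : ∃ b, π.sentBit x y h = some b := by
    cases q <;> exact ⟨_, by rw [sentBit, hq]⟩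
  obtain ⟨r, hr⟩ := (C b).support_nonempty
  have hmem : h ++ [r] ∈ (π.historyLaw C x y (n + 1)).support := by
    rw [historyLaw_succ, PMF.mem_support_bind_iff]
    refine ⟨h, hh, ?_⟩
    rw [stepLaw, hb]
    exact (PMF.mem_support_map_iff _ _ _).2 ⟨r, hr, rfl⟩
  have := length_le_of_mem_support hT hmem
  simp at this
  omega

theorem _root_.PMF.bind_congr_support {α : Type u} {β : Type v} (p : PMF α) {f g : α → PMF β}
    (h : ∀ a ∈ p.support, f a = g a) : p.bind f = p.bind g := by
  ext b
  simp only [PMF.bind_apply]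
  refine tsum_congr fun a => ?_
  by_cases ha : p a = 0
  · simp [ha]
  · rw [h a ha]

/-- Truncation alters only histories of probability zero, and it makes the length bound hold at
every history, as the simulation needs. -/
theorem historyLaw_truncate {C : Bool → PMF Bool} {π : Protocol X Y} {T : ℕ}
    (hT : π.channelCC C = T) (x : X) (y : Y) (n : ℕ) :
    (π.truncate T).historyLaw C x y n = π.historyLaw C x y n := by
  induction n with
  | zero => rfl
  | succ n ih =>
    rw [historyLaw_succ, historyLaw_succ, ih]
    refine PMF.bind_congr_support _ fun h hh => ?_
    unfold stepLaw sentBit truncate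
    by_cases hn : T ≤ h.length
    · simp [hn, next_eq_none_of_mem_support hT hh hn]
    · simp [hn]

theorem transcriptProb_eq_historyLaw {C : Bool → PMF Bool} {π : Protocol X Y} {T : ℕ}
    (hT : π.channelCC C = T) (x : X) (y : Y) (t : List Bool) :
    π.transcriptProb C x y t = π.historyLaw C x y T t := by
  have hdone : ∀ h ∈ (π.historyLaw C x y T).support, π.next h = none := by
    intro h hh
    by_contra hne
    exact hne (next_eq_none_of_mem_support hT hh (length_eq_of_mem_support hh hne).ge)
  rw [transcriptProb]
  split_ifs with ht
  · have hmono : Monotone fun n => π.historyLaw C x y n t := by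
      refine monotone_nat_of_le_succ fun n => ?_
      rw [historyLaw_succ, PMF.bind_apply]
      refine le_trans (le_of_eq ?_) (ENNReal.le_tsum t)
      simp [stepLaw, sentBit, ht]
    have hconst : ∀ n, π.historyLaw C x y (T + n) = π.historyLaw C x y T := by
      intro n
      induction n with
      | zero => rfl
      | succ n ih =>
        rw [← add_assoc, historyLaw_succ, ih,
          PMF.bind_congr_support _ (g := PMF.pure) fun h hh => by simp [stepLaw, sentBit, hdone h hh],
          PMF.bind_pure]
    refine le_antisymm (iSup_le fun n => ?_) (le_iSup (fun n => π.historyLaw C x y n t) T)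
    rw [← hconst n]
    exact hmono (by omega)
  · symm
    rw [PMF.apply_eq_zero_iff]
    exact fun hh => ht (hdone t hh)

theorem transcriptProb_eq_completion {C : Bool → PMF Bool} {π : Protocol X Y} {T : ℕ}
    (hT : π.channelCC C = T) (x : X) (y : Y) (t : List Bool) :
    π.transcriptProb C x y t = (π.truncate T).completion C x y T [] t := by
  rw [transcriptProb_eq_historyLaw hT, completion_eq_historyLaw, historyLaw_truncate hT]

theorem stepLaw_of_next_some (C : Bool → PMF Bool) (π : Protocol X Y) (x : X) (y : Y)
    {h : List Bool} {q : Party} (hq : π.next h = some q) :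
    ∃ b, π.stepLaw C x y h = (C b).map fun r => h ++ [r] := by
  cases q <;> exact ⟨_, by rw [stepLaw, sentBit, hq]⟩

/-- Over a channel whose output does not depend on its input, the transcript carries no
information about the inputs. -/
theorem completion_eq_of_const {C : Bool → PMF Bool} (hC : ∀ b b', C b = C b') (π : Protocol X Y)
    (x x' : X) (y y' : Y) (n : ℕ) (h : List Bool) :
    π.completion C x y n h = π.completion C x' y' n h := by
  induction n generalizing h with
  | zero => rfl
  | succ n ih =>
    have hstep : π.stepLaw C x y h = π.stepLaw C x' y' h := by
      cases hq : π.next h with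
      | none => simp [stepLaw, sentBit, hq]
      | some q =>
        obtain ⟨b, hb⟩ := stepLaw_of_next_some C π x y hq
        obtain ⟨b', hb'⟩ := stepLaw_of_next_some C π x' y' hq
        rw [hb, hb', hC b b']
    rw [completion, completion, hstep]
    congr 1
    exact funext ih

end Protocol

/-! ### Choice of the block length and conclusion -/

/-- The least `m` with the lower bound works: since `131072 = 16 · 8192`, failure at `m - 1` is the
upper bound at `m`. For `m = 0` blocks are single bits and no smallness of `ε` is needed. -/
theorem exists_block_exponent {ε : ℝ} (h0 : 0 < ε) :
    ∃ m : ℕ, (m ≠ 0 → 8192 * ε ^ 2 * 16 ^ m ≤ 1) ∧ 1 ≤ 131072 * ε ^ 2 * 16 ^ m := by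
  classical
  have hex : ∃ m : ℕ, 1 ≤ 131072 * ε ^ 2 * 16 ^ m := by
    obtain ⟨m, hm⟩ := pow_unbounded_of_one_lt (131072 * ε ^ 2)⁻¹ (by norm_num : (1 : ℝ) < 16)
    refine ⟨m, ?_⟩
    rw [inv_lt_iff_one_lt_mul₀' (by positivity)] at hm
    exact hm.le
  refine ⟨Nat.find hex, fun hne => ?_, Nat.find_spec hex⟩
  have hmin := Nat.find_min hex (Nat.sub_one_lt hne)
  rw [not_le] at hmin
  have hpow : (16 : ℝ) ^ Nat.find hex = 16 ^ (Nat.find hex - 1) * 16 := by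
    rw [← pow_succ, Nat.sub_add_cancel (Nat.one_le_iff_ne_zero.2 hne)]
  rw [hpow]
  linarith

theorem theorem3p1 :
    ∃ α : ℝ, 0 < α ∧
      ∀ (X : Type*) (Y : Type*) (ε : ℝ) (hε : 1 / 2 - ε ∈ Set.Icc (0 : ℝ) (1 / 2))
        (π : Protocol X Y) (T : ℕ), π.channelCC (bsc (1 / 2 - ε) hε) = T →
        ∃ φ : PublicCoinProtocol X Y,
          φ.Simulates (bsc (1 / 2 - ε) hε) π ∧
          φ.avgCC ≤ ENNReal.ofReal (α * (⌈2 * ε ^ 2 * (T : ℝ)⌉ : ℝ)) := by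
  -- The cost is 5633 per block; the number of blocks is at most `65536 · 2 ε ^ 2 T + 1`, and the
  -- ceiling is at least 1 when `ε` and `T` are positive.
  refine ⟨5633 * 65537, by norm_num, fun X Y ε hε π T hT => ?_⟩
  have h0 : 0 ≤ ε := by linarith [hε.2]
  have h1 : ε ≤ 1 / 2 := by linarith [hε.1]
  have hbound : ∀ h : List Bool, T ≤ h.length → (π.truncate T).next h = none :=
    fun h hh => if_pos hh
  suffices hs : Sampleable (fun x y => (π.truncate T).completion (bsc (1 / 2 - ε) hε) x y T [])
      fun _ _ => ENNReal.ofReal (5633 * 65537 * (⌈2 * ε ^ 2 * (T : ℝ)⌉ : ℝ)) from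
    hs.exists_publicCoinProtocol _ _ (Protocol.transcriptProb_eq_completion hT) fun _ _ => le_rfl
  rcases Nat.eq_zero_or_pos T with rfl | hTpos
  · exact (Sampleable.pure []).mono fun _ _ => zero_le
  -- For `ε = 0` the bound is zero bits: the received bits are uniform whatever is sent, so public
  -- coins alone sample the transcript.
  rcases h0.eq_or_lt with rfl | hpos
  · have hC : ∀ b b', bsc (1 / 2 - 0) hε b = bsc (1 / 2 - 0) hε b' := by
      intro b b'
      ext r
      change ENNReal.ofReal _ = ENNReal.ofReal _
      congr 1
      split_ifs <;> norm_num
    by_cases hne : Nonempty X ∧ Nonempty Y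
    · obtain ⟨⟨x₀⟩, ⟨y₀⟩⟩ := hne
      exact ((Sampleable.publicCoin _).congr fun x y =>
        Protocol.completion_eq_of_const hC _ x₀ x y₀ y T []).mono fun _ _ => zero_le
    · exact (Sampleable.pure []).congr (fun x y => absurd ⟨⟨x⟩, ⟨y⟩⟩ hne) |>.mono
        fun _ _ => zero_le
  · obtain ⟨m, hm, hmax⟩ := exists_block_exponent hpos
    refine ((π.truncate T).sampleable_completion_of_blocks hbound h0 h1 hε hm).mono fun _ _ => ?_
    have hTpos' : (0 : ℝ) < T := by exact_mod_cast hTpos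
    have hceil : (1 : ℝ) ≤ (⌈2 * ε ^ 2 * (T : ℝ)⌉ : ℝ) := by
      exact_mod_cast Int.one_le_ceil_iff.2 (by positivity)
    have hle := Int.le_ceil (2 * ε ^ 2 * (T : ℝ))
    have hblocks : ((T / 16 ^ m + 1 : ℕ) : ℝ) ≤ 65537 * (⌈2 * ε ^ 2 * (T : ℝ)⌉ : ℝ) := by
      have hdiv : ((T / 16 ^ m : ℕ) : ℝ) ≤ 65536 * (2 * ε ^ 2 * T) := by
        refine (Nat.cast_div_le).trans ?_
        push_cast
        rw [div_le_iff₀ (by positivity)]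
        calc (T : ℝ) = T * 1 := (mul_one _).symm
          _ ≤ T * (131072 * ε ^ 2 * 16 ^ m) := by gcongr
          _ = _ := by ring
      push_cast at hdiv ⊢
      linarith
    calc (5633 : ℝ≥0∞) * ((T / 16 ^ m + 1 : ℕ) : ℝ≥0∞)
        = ENNReal.ofReal (5633 * ((T / 16 ^ m + 1 : ℕ) : ℝ)) := by
          rw [ENNReal.ofReal_mul (by norm_num), ENNReal.ofReal_natCast]
          norm_num
      _ ≤ _ := by
          apply ENNReal.ofReal_le_ofReal
          rw [mul_assoc]
          gcongr
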